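/- Let $L,T,\mu>0$, $\lambda_0<\lambda_*$, and let $n_0\ge 1$ be an integer. Let $f\ge 0$ and $c^0>0$ on $[0,L]$, $I:[\lambda_0,\lambda_*]\to[0,1]$, $\varepsilon_A,\varepsilon_B:[\lambda_0,\lambda_*]\to\mathbb R$, and let $\rho:[0,\infty)\to[0,\infty)$ be bounded (for instance $\rho(X)=a_1X/(X^2+a_2X+1)$ with $a_1>0$, $a_2\ge0$). Assume that $f,c^0\in C^{n_0+1}([0,L])$, $I,\varepsilon_A,\varepsilon_B\in C^{n_0+1}([\lambda_0,\lambda_*])$ and $\rho\in C^{n_0+1}([0,\infty))$. Put $C_0(x)=\int_0^x c^0(\xi)\,d\xi$ and $$\iota(\lambda,C,S)=I(\lambda)\exp\{-\mu(\varepsilon_B(\lambda)C+(\varepsilon_A(\lambda)-\varepsilon_B(\lambda))S)\}.$$ Let $c$ be a classical solution (continuous, differentiable in $t$) on $[0,L]\times[0,T]$ of $$\partial_t c(x,t)=-c(x,t)f(x)\int_{\lambda_0}^{\lambda_*}\rho\Big(\iota\Big(\lambda,C_0(x),\int_0^x c(\xi,t)\,d\xi\Big)\Big)d\lambda,\qquad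 c(x,0)=c^0(x).$$ For a step $h>0$ and $n\ge n_0$, let $$Q_n^h[g]=h\Big(\sum_{\mu=0}^{n_0-1}w_{n\mu}\,g_\mu+\sum_{\nu=n_0}^{n}\omega_{n-\nu}\,g_\nu\Big)$$ be the $(n_0-1)$-th Gregory rule, i.e. $$Q_n^h[g]=h\Big(\tfrac{g_0}{2}+g_1+\dots+g_{n-1}+\tfrac{g_n}{2}\Big)-h\sum_{k=1}^{n_0-1}|G_{k+1}|\big(\nabla^k g_n+(-1)^k\Delta^k g_0\big),\qquad G_k=\int_0^1\binom{s}{k}ds.$$ For integers $N_x,N_t\ge1$, $N_\lambda\ge n_0$ put $\Delta x=L/N_x$, $\Delta t=T/N_t$, $\Delta\lambda=(\lambda_*-\lambda_0)/N_\lambda$, $x_j=j\Delta x$, $t_n=n\Delta t$, $\lambda_l=\lambda_0+l\Delta\lambda$. A DQ approximation is a grid function $c_j^n$ $(0\le j\le N_x,\ 0\le n\le N_t)$ with $c_j^0=c^0(x_j)$ which, for all $j,n\ge n_0$, is positive and satisfies the Gregory discretization of the logarithmic Volterra form of the problem, $$\log\frac{c_j^n}{c_j^0}=-f(x_j)\,Q_n^{\Delta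 t}\Big[\,p\mapsto Q_{N_\lambda}^{\Delta\lambda}\big[\,l\mapsto\rho\big(\iota(\lambda_l,C_0(x_j),Q_j^{\Delta x}[k\mapsto c_k^p])\big)\big]\Big];$$ the values $c_j^n$ with $j<n_0$ or $n<n_0$ are the given starting values. Then the DQ method is convergent of order $n_0+1$ whenever the starting errors are $O((\Delta x+\Delta t+\Delta\lambda)^{n_0+1})$: for every constant $K$ there is a constant $\kappa>0$, independent of $N_x,N_t,N_\lambda$ and of the DQ approximation, such that for every DQ approximation with $$|c(x_j,t_n)-c_j^n|\le K(\Delta x+\Delta t+\Delta\lambda)^{n_0+1}\quad\text{for all } j\le N_x,\ n\le N_t\text{ with } j<n_0\text{ or }n<n_0$$ one has $$\max_{0\le j\le N_x,\ 0\le n\le N_t}|c(x_j,t_n)-c_j^n|\le\kappa\,(\Delta x+\Delta t+\Delta\lambda)^{n_0+1}.$$ -/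

import Mathlib

open Set MeasureTheory

noncomputable section

/-! ### Gregory quadrature -/

/-- The Gregory coefficients `G_k = ∫₀¹ s (s-1) ⋯ (s-k+1) / k! ds`, that is
`1, 1/2, -1/12, 1/24, -19/720, …`. -/
def gregoryCoeff (k : ℕ) : ℝ :=
  ∫ s in (0 : ℝ)..1, (∏ i ∈ Finset.range k, (s - (i : ℝ))) / (k.factorial : ℝ)

/-- Convolution weights `ω_ν` of the `(n₀-1)`-th Gregory rule, i.e. of
`∫₀^{nh} g ≈ h (g₀/2 + g₁ + ⋯ + g_{n-1} + g_n/2)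
    - h ∑_{k=1}^{n₀-1} |G_{k+1}| (∇ᵏ g_n + (-1)ᵏ Δᵏ g₀)`,
where `|G_{k+1}| = (-1)ᵏ G_{k+1}` for `k ≥ 1` and
`∇ᵏ g_n = ∑_ν (-1)^ν (k choose ν) g_{n-ν}`. One has `ω_ν = 1` for `ν ≥ n₀`. -/
def gregoryOmega (n₀ ν : ℕ) : ℝ :=
  (if ν = 0 then 1 / 2 else 1)
    - ∑ k ∈ Finset.Icc 1 (n₀ - 1),
        (-1 : ℝ) ^ k * gregoryCoeff (k + 1) * ((-1 : ℝ) ^ ν * (k.choose ν : ℝ))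

/-- Starting weights `w_{n μ}` (`μ < n₀ ≤ n`) of the `(n₀-1)`-th Gregory rule: at a node `μ` the
trapezoidal weight `1` receives the correction `ω_μ - 1` from the left end point and the
correction `ω_{n-μ} - 1` from the right end point. -/
def gregoryStart (n₀ n μ : ℕ) : ℝ :=
  gregoryOmega n₀ μ + gregoryOmega n₀ (n - μ) - 1

/-- The `(n₀-1)`-th Gregory rule with step `h` on the `n + 1` nodes `0, …, n` (`n ≥ n₀`). -/
def gregorySum (n₀ : ℕ) (h : ℝ) (n : ℕ) (g : ℕ → ℝ) : ℝ :=
  h * (∑ μ ∈ Finset.range n₀, gregoryStart n₀ n μ * g μ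
    + ∑ ν ∈ Finset.Icc n₀ n, gregoryOmega n₀ (n - ν) * g ν)

/-! ### The continuous model -/

/-- The data of the photocatalytic reaction model on `[0,L] × [0,T]`, with wavelengths in
`[lam0, lamS]`. -/
structure PhotoModel where
  L : ℝ
  T : ℝ
  lam0 : ℝ
  lamS : ℝ
  mu : ℝ
  f : ℝ → ℝ
  c0 : ℝ → ℝ
  I : ℝ → ℝ
  epsA : ℝ → ℝ
  epsB : ℝ → ℝ
  rho : ℝ → ℝ

namespace PhotoModel

/-- Sign conditions on the data, and boundedness of `rho` on `[0, ∞)`. -/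
structure Admissible (M : PhotoModel) : Prop where
  L_pos : 0 < M.L
  T_pos : 0 < M.T
  lam_lt : M.lam0 < M.lamS
  mu_pos : 0 < M.mu
  f_nonneg : ∀ x ∈ Icc 0 M.L, 0 ≤ M.f x
  c0_pos : ∀ x ∈ Icc 0 M.L, 0 < M.c0 x
  I_mem : ∀ l ∈ Icc M.lam0 M.lamS, M.I l ∈ Icc (0 : ℝ) 1
  rho_nonneg : ∀ X : ℝ, 0 ≤ X → 0 ≤ M.rho X
  rho_bdd : ∃ R : ℝ, ∀ X : ℝ, 0 ≤ X → M.rho X ≤ R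

/-- All given functions are of class `C^p` on their (closed) domains. -/
structure Smooth (M : PhotoModel) (p : ℕ) : Prop where
  f_smooth : ContDiffOn ℝ (p : WithTop ℕ∞) M.f (Icc 0 M.L)
  c0_smooth : ContDiffOn ℝ (p : WithTop ℕ∞) M.c0 (Icc 0 M.L)
  I_smooth : ContDiffOn ℝ (p : WithTop ℕ∞) M.I (Icc M.lam0 M.lamS)
  epsA_smooth : ContDiffOn ℝ (p : WithTop ℕ∞) M.epsA (Icc M.lam0 M.lamS)
  epsB_smooth : ContDiffOn ℝ (p : WithTop ℕ∞) M.epsB (Icc M.lam0 M.lamS)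
  rho_smooth : ContDiffOn ℝ (p : WithTop ℕ∞) M.rho (Ici 0)

/-- `C₀(x) = ∫₀ˣ c⁰(ξ) dξ`. -/
def C0 (M : PhotoModel) (x : ℝ) : ℝ := ∫ ξ in (0 : ℝ)..x, M.c0 ξ

/-- The light intensity
`ι(λ, C, S) = I(λ) exp(-μ (ε_B(λ) C + (ε_A(λ) - ε_B(λ)) S))`. -/
def iota (M : PhotoModel) (l C S : ℝ) : ℝ :=
  M.I l * Real.exp (-M.mu * (M.epsB l * C + (M.epsA l - M.epsB l) * S))

/-- `c` is a classical solution on `[0,L] × [0,T]` of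
`∂c/∂t (x,t) = -c(x,t) f(x) ∫_{λ₀}^{λ_*} ρ(ι(λ, C₀(x), ∫₀ˣ c(ξ,t) dξ)) dλ`, `c(x,0) = c⁰(x)`. -/
structure IsSolution (M : PhotoModel) (c : ℝ → ℝ → ℝ) : Prop where
  continuousOn : ContinuousOn (fun z : ℝ × ℝ => c z.1 z.2) (Icc 0 M.L ×ˢ Icc 0 M.T)
  init : ∀ x ∈ Icc 0 M.L, c x 0 = M.c0 x
  hasDeriv : ∀ x ∈ Icc 0 M.L, ∀ t ∈ Icc 0 M.T,
    HasDerivWithinAt (fun s => c x s)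
      (-c x t * M.f x * ∫ l in M.lam0..M.lamS, M.rho (M.iota l (M.C0 x) (∫ ξ in (0 : ℝ)..x, c ξ t)))
      (Icc 0 M.T) t

/-! ### The direct quadrature scheme -/

/-- `Δx = L / N_x`. -/
def dx (M : PhotoModel) (Nx : ℕ) : ℝ := M.L / (Nx : ℝ)

/-- `Δt = T / N_t`. -/
def dt (M : PhotoModel) (Nt : ℕ) : ℝ := M.T / (Nt : ℝ)

/-- `Δλ = (λ_* - λ₀) / N_λ`. -/
def dlam (M : PhotoModel) (Nl : ℕ) : ℝ := (M.lamS - M.lam0) / (Nl : ℝ)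

/-- The Gregory approximation of `∫₀^{x_j} c(ξ, t_p) dξ` from the grid values `C k p`. -/
def dqSpace (M : PhotoModel) (n₀ Nx : ℕ) (C : ℕ → ℕ → ℝ) (j p : ℕ) : ℝ :=
  gregorySum n₀ (M.dx Nx) j (fun k => C k p)

/-- The Gregory approximation of the integral over `[λ₀, λ_*]` at `(x_j, t_p)`. -/
def dqLight (M : PhotoModel) (n₀ Nx Nl : ℕ) (C : ℕ → ℕ → ℝ) (j p : ℕ) : ℝ :=
  gregorySum n₀ (M.dlam Nl) Nl (fun l =>
    M.rho (M.iota (M.lam0 + (l : ℝ) * M.dlam Nl) (M.C0 ((j : ℝ) * M.dx Nx))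
      (M.dqSpace n₀ Nx C j p)))

/-- The grid function `C j n` (`j ≤ N_x`, `n ≤ N_t`) is computed by the `n₀`-step DQ scheme: it
takes the initial values `C j 0 = c⁰(x_j)`, and for `j, n ≥ n₀` it is positive and satisfies
the discrete equations. The values with `j < n₀` or `n < n₀` are the starting values. The part of
the time sum over the indices `m < n₀` is the term `σ_j`. -/
structure IsDQ (M : PhotoModel) (n₀ Nx Nt Nl : ℕ) (C : ℕ → ℕ → ℝ) : Prop where
  init : ∀ j ≤ Nx, C j 0 = M.c0 ((j : ℝ) * M.dx Nx)
  pos : ∀ j n : ℕ, n₀ ≤ j → j ≤ Nx → n₀ ≤ n → n ≤ Nt → 0 < C j n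
  scheme : ∀ j n : ℕ, n₀ ≤ j → j ≤ Nx → n₀ ≤ n → n ≤ Nt →
    Real.log (C j n / C j 0)
      = -M.f ((j : ℝ) * M.dx Nx) *
          gregorySum n₀ (M.dt Nt) n (fun p => M.dqLight n₀ Nx Nl C j p)

end PhotoModel

end

noncomputable section

/-- The end-point correction weights of the `(n₀-1)`-th Gregory rule. -/
def gregoryCorr (n₀ ν : ℕ) : ℝ :=
  ∑ k ∈ Finset.Icc 1 (n₀ - 1),
    (-1 : ℝ) ^ k * gregoryCoeff (k + 1) * ((-1 : ℝ) ^ ν * (k.choose ν : ℝ))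

lemma gregoryOmega_eq (n₀ ν : ℕ) :
    gregoryOmega n₀ ν = 1 - (if ν = 0 then 1 / 2 else 0) - gregoryCorr n₀ ν := by
  unfold gregoryOmega gregoryCorr
  split_ifs <;> ring

lemma gregoryCorr_eq_zero {n₀ ν : ℕ} (hn₀ : 1 ≤ n₀) (h : n₀ ≤ ν) : gregoryCorr n₀ ν = 0 := by
  refine Finset.sum_eq_zero fun k hk => ?_
  rw [Finset.mem_Icc] at hk
  rw [Nat.choose_eq_zero_of_lt (by omega)]
  simp

lemma gregorySum_eq_sum_range {n₀ n : ℕ} (hn₀ : 1 ≤ n₀) (hn : n₀ ≤ n) (h : ℝ) (g : ℕ → ℝ) :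
    gregorySum n₀ h n g
      = h * ∑ ν ∈ Finset.range (n + 1),
          (gregoryOmega n₀ ν + gregoryOmega n₀ (n - ν) - 1) * g ν := by
  unfold gregorySum gregoryStart
  congr 1
  rw [← Finset.sum_range_add_sum_Ico _ (show n₀ ≤ n + 1 by omega)]
  congr 1
  refine Finset.sum_congr (by ext; simp) fun ν hν => ?_
  rw [Finset.mem_Ico] at hν
  rw [gregoryOmega_eq n₀ ν, gregoryCorr_eq_zero hn₀ hν.1, if_neg (by omega)]
  ring

lemma gregorySum_eq {n₀ n : ℕ} (hn₀ : 1 ≤ n₀) (hn : n₀ ≤ n) (h : ℝ) (g : ℕ → ℝ) :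
    gregorySum n₀ h n g
      = h * (∑ ν ∈ Finset.range (n + 1), g ν - (g 0 + g n) / 2
          - ∑ ν ∈ Finset.range n₀, gregoryCorr n₀ ν * (g ν + g (n - ν))) := by
  have key : ∀ G : ℕ → ℝ, ∑ ν ∈ Finset.range (n + 1), gregoryOmega n₀ ν * G ν
      = ∑ ν ∈ Finset.range (n + 1), G ν - G 0 / 2
        - ∑ ν ∈ Finset.range n₀, gregoryCorr n₀ ν * G ν := by
    intro G
    have h1 : ∑ ν ∈ Finset.range (n + 1), (if ν = 0 then (1 / 2 : ℝ) else 0) * G ν = G 0 / 2 := by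
      rw [Finset.sum_eq_single 0]
      · simp; ring
      · intro b _ hb; simp [hb]
      · simp
    have h2 : ∑ ν ∈ Finset.range (n + 1), gregoryCorr n₀ ν * G ν
        = ∑ ν ∈ Finset.range n₀, gregoryCorr n₀ ν * G ν := by
      symm
      refine Finset.sum_subset (by intro x; simp; omega) fun x _ hx => ?_
      rw [gregoryCorr_eq_zero hn₀ (by simpa using hx)]; simp
    rw [← h1, ← h2, ← Finset.sum_sub_distrib, ← Finset.sum_sub_distrib]
    refine Finset.sum_congr rfl fun ν _ => ?_
    rw [gregoryOmega_eq]; ring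
  have hrefl : ∑ ν ∈ Finset.range (n + 1), gregoryOmega n₀ (n - ν) * g ν
      = ∑ ν ∈ Finset.range (n + 1), gregoryOmega n₀ ν * g (n - ν) := by
    rw [← Finset.sum_range_reflect]
    refine Finset.sum_congr rfl fun ν hν => ?_
    rw [Finset.mem_range] at hν
    rw [show n + 1 - 1 - ν = n - ν by omega, show n - (n - ν) = ν by omega]
  have hrefl' : ∑ ν ∈ Finset.range (n + 1), g (n - ν) = ∑ ν ∈ Finset.range (n + 1), g ν := by
    rw [← Finset.sum_range_reflect]
    refine Finset.sum_congr rfl fun ν hν => ?_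
    rw [Finset.mem_range] at hν
    rw [show n + 1 - 1 - ν = n - ν by omega, show n - (n - ν) = ν by omega]
  rw [gregorySum_eq_sum_range hn₀ hn]
  congr 1
  have : ∀ ν, (gregoryOmega n₀ ν + gregoryOmega n₀ (n - ν) - 1) * g ν
      = gregoryOmega n₀ ν * g ν + gregoryOmega n₀ (n - ν) * g ν - g ν := fun ν => by ring
  simp only [this]
  rw [Finset.sum_sub_distrib, Finset.sum_add_distrib, hrefl, key, key, hrefl']
  simp only [mul_add, Finset.sum_add_distrib, Nat.sub_zero]
  ring

/-- A bound for the weights of the Gregory rule. -/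
def gregoryWeightBound (n₀ : ℕ) : ℝ := 3 + 2 * ∑ ν ∈ Finset.range n₀, |gregoryCorr n₀ ν|

lemma gregoryWeightBound_nonneg (n₀ : ℕ) : 0 ≤ gregoryWeightBound n₀ := by
  have := Finset.sum_nonneg (s := Finset.range n₀) fun ν _ => abs_nonneg (gregoryCorr n₀ ν)
  unfold gregoryWeightBound; linarith

lemma abs_gregorySum_le {n₀ n : ℕ} (hn₀ : 1 ≤ n₀) (hn : n₀ ≤ n) {h : ℝ} (hh : 0 ≤ h)
    (g : ℕ → ℝ) :
    |gregorySum n₀ h n g|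
      ≤ gregoryWeightBound n₀ * (h * ∑ ν ∈ Finset.range (n + 1), |g ν|) := by
  have hcorr : ∀ ν, |gregoryCorr n₀ ν| ≤ ∑ ν ∈ Finset.range n₀, |gregoryCorr n₀ ν| := by
    intro ν
    by_cases hν : ν < n₀
    · exact Finset.single_le_sum (f := fun ν => |gregoryCorr n₀ ν|)
        (fun i _ => abs_nonneg _) (Finset.mem_range.2 hν)
    · rw [gregoryCorr_eq_zero hn₀ (by omega), abs_zero]
      exact Finset.sum_nonneg fun i _ => abs_nonneg _
  have homega : ∀ ν, |gregoryOmega n₀ ν| ≤ 1 + ∑ ν ∈ Finset.range n₀, |gregoryCorr n₀ ν| := by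
    intro ν
    rw [gregoryOmega_eq]
    refine (abs_sub _ _).trans (add_le_add ?_ (hcorr ν))
    split_ifs <;> norm_num [abs_le]
  rw [gregorySum_eq_sum_range hn₀ hn, abs_mul, abs_of_nonneg hh, mul_left_comm, Finset.mul_sum]
  refine mul_le_mul_of_nonneg_left ((Finset.abs_sum_le_sum_abs _ _).trans
    (Finset.sum_le_sum fun ν _ => ?_)) hh
  rw [abs_mul]
  refine mul_le_mul_of_nonneg_right ?_ (abs_nonneg _)
  have h1 := abs_le.1 (homega ν)
  have h2 := abs_le.1 (homega (n - ν))
  unfold gregoryWeightBound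
  rw [abs_le]; constructor <;> linarith [h1.1, h1.2, h2.1, h2.2]

lemma gregorySum_sub (n₀ n : ℕ) (h : ℝ) (g g' : ℕ → ℝ) :
    gregorySum n₀ h n g - gregorySum n₀ h n g' = gregorySum n₀ h n (fun k => g k - g' k) := by
  simp only [gregorySum, mul_sub, Finset.sum_sub_distrib]
  ring

lemma abs_gregorySum_le_of_bound {n₀ n : ℕ} (hn₀ : 1 ≤ n₀) (hn : n₀ ≤ n) {h X B : ℝ}
    (hh : 0 ≤ h) (hX : (n : ℝ) * h ≤ X) {g : ℕ → ℝ} (hB : 0 ≤ B) (hg : ∀ ν ≤ n, |g ν| ≤ B) :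
    |gregorySum n₀ h n g| ≤ gregoryWeightBound n₀ * (2 * X * B) := by
  refine (abs_gregorySum_le hn₀ hn hh g).trans
    (mul_le_mul_of_nonneg_left ?_ (gregoryWeightBound_nonneg n₀))
  have h1 : ∑ ν ∈ Finset.range (n + 1), |g ν| ≤ ((n : ℝ) + 1) * B := by
    refine (Finset.sum_le_card_nsmul _ _ B fun ν hν => hg ν ?_).trans (by simp)
    rw [Finset.mem_range] at hν; omega
  have h2 : (1 : ℝ) ≤ n := by exact_mod_cast hn₀.trans hn
  have h3 : h * (((n : ℝ) + 1)) ≤ 2 * X := by nlinarith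
  calc h * ∑ ν ∈ Finset.range (n + 1), |g ν| ≤ h * (((n : ℝ) + 1) * B) :=
        mul_le_mul_of_nonneg_left h1 hh
    _ = (h * ((n : ℝ) + 1)) * B := by ring
    _ ≤ _ := mul_le_mul_of_nonneg_right h3 hB

open Polynomial in
lemma Polynomial.eq_zero_of_descPochhammer (Φ : ℝ[X] →ₗ[ℝ] ℝ) (d : ℕ)
    (hΦ : ∀ m ≤ d, Φ (descPochhammer ℝ m) = 0) (P : ℝ[X]) (hP : P.natDegree ≤ d) : Φ P = 0 := by
  induction d generalizing P with
  | zero =>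
    obtain ⟨a, rfl⟩ := natDegree_eq_zero.1 (Nat.le_zero.1 hP)
    have h := hΦ 0 le_rfl
    rw [descPochhammer_zero] at h
    rw [← mul_one (C a), ← smul_eq_C_mul, map_smul, h, smul_zero]
  | succ d ih =>
    have hd : (descPochhammer ℝ (d + 1)).natDegree = d + 1 := descPochhammer_natDegree _ _
    have hm : (descPochhammer ℝ (d + 1)).coeff (d + 1) = 1 := by
      have := monic_descPochhammer ℝ (d + 1)
      rwa [Monic, leadingCoeff, hd] at this
    have h := ih (fun m hm => hΦ m (by omega))
      (P - P.coeff (d + 1) • descPochhammer ℝ (d + 1)) ?_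
    · rw [map_sub, map_smul, hΦ _ le_rfl, smul_zero, sub_zero] at h
      exact h
    · refine natDegree_le_iff_coeff_eq_zero.2 fun N hN => ?_
      rcases Nat.lt_or_ge (d + 1) N with h | h
      · rw [coeff_sub, coeff_smul, coeff_eq_zero_of_natDegree_lt (hP.trans_lt h),
          coeff_eq_zero_of_natDegree_lt (hd.le.trans_lt h)]
        simp
      · obtain rfl : N = d + 1 := by omega
        simp [hm]

lemma descPochhammer_eval_real_nat (m ν : ℕ) :
    (descPochhammer ℝ m).eval (ν : ℝ) = (m.factorial : ℝ) * (ν.choose m : ℝ) := by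
  rw [descPochhammer_eval_eq_descFactorial, Nat.descFactorial_eq_factorial_mul_choose]
  push_cast; rfl

lemma integral_descPochhammer (m : ℕ) :
    ∫ s in (0 : ℝ)..1, (descPochhammer ℝ m).eval s = (m.factorial : ℝ) * gregoryCoeff m := by
  unfold gregoryCoeff
  rw [intervalIntegral.integral_div, mul_div_cancel₀ _ (by positivity)]
  refine intervalIntegral.integral_congr fun s _ => ?_
  exact descPochhammer_eval_eq_prod_range m s

lemma sum_neg_one_pow_choose_mul_choose (k m : ℕ) :
    ∑ ν ∈ Finset.range (k + 1), (-1 : ℝ) ^ (k + ν) * (k.choose ν : ℝ) * (ν.choose m : ℝ)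
      = if k = m then 1 else 0 := by
  have h := fwdDiff_iter_choose_zero m k
  rw [fwdDiff_iter_eq_sum_shift] at h
  have h' := congrArg (Int.cast : ℤ → ℝ) h
  push_cast at h'
  rw [← h']
  refine Finset.sum_congr rfl fun ν hν => ?_
  rw [Finset.mem_range] at hν
  obtain ⟨j, rfl⟩ := Nat.exists_eq_add_of_le (show ν ≤ k by omega)
  rw [show ν + j + ν = j + 2 * ν by ring, pow_add, pow_mul]
  simp

/-- Summation against the correction weights, in terms of forward differences. -/
lemma sum_gregoryCorr_mul {n₀ : ℕ} (hn₀ : 1 ≤ n₀) (g : ℕ → ℝ) :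
    ∑ ν ∈ Finset.range n₀, gregoryCorr n₀ ν * g ν
      = ∑ k ∈ Finset.Icc 1 (n₀ - 1), gregoryCoeff (k + 1) *
          ∑ ν ∈ Finset.range (k + 1), (-1 : ℝ) ^ (k + ν) * (k.choose ν : ℝ) * g ν := by
  simp only [gregoryCorr, Finset.sum_mul]
  rw [Finset.sum_comm]
  refine Finset.sum_congr rfl fun k hk => ?_
  rw [Finset.mem_Icc] at hk
  rw [Finset.mul_sum]
  symm
  refine (Finset.sum_subset (show Finset.range (k + 1) ⊆ Finset.range n₀ by
    intro x; simp; omega) fun ν _ hν => ?_).trans (Finset.sum_congr rfl fun ν _ => ?_)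
  · rw [Nat.choose_eq_zero_of_lt (by simpa using hν)]; simp
  · rw [pow_add]; ring

lemma gregoryCoeff_zero : gregoryCoeff 0 = 1 := by simp [gregoryCoeff]

lemma gregoryCoeff_one : gregoryCoeff 1 = 1 / 2 := by simp [gregoryCoeff]

lemma sum_gregoryCorr_mul_choose {n₀ : ℕ} (hn₀ : 1 ≤ n₀) (m : ℕ) (hm : m ≤ n₀) :
    ∑ ν ∈ Finset.range n₀, gregoryCorr n₀ ν * (((ν + 1).choose m : ℝ) - (ν.choose m : ℝ))
      = if 2 ≤ m then gregoryCoeff m else 0 := by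
  rcases m with _ | m
  · simp
  have h1 : ∀ ν : ℕ, (((ν + 1).choose (m + 1) : ℝ) - (ν.choose (m + 1) : ℝ)) = (ν.choose m : ℝ) := by
    intro ν; rw [Nat.choose_succ_succ]; push_cast; ring
  simp only [h1]
  rw [sum_gregoryCorr_mul hn₀]
  simp only [sum_neg_one_pow_choose_mul_choose]
  by_cases h : 1 ≤ m
  · rw [if_pos (by omega), Finset.sum_eq_single m]
    · simp
    · intro b _ hb; simp [hb]
    · intro hm'; exact absurd (Finset.mem_Icc.2 ⟨h, by omega⟩) hm'
  · rw [if_neg (by omega)]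
    refine Finset.sum_eq_zero fun k hk => ?_
    rw [Finset.mem_Icc] at hk
    rw [if_neg (by omega), mul_zero]

/-- The local rule by which consecutive Gregory rules differ is exact for degree `≤ n₀`. -/
lemma gregory_step_exact {n₀ : ℕ} (hn₀ : 1 ≤ n₀) (P : Polynomial ℝ) (hP : P.natDegree ≤ n₀) :
    (P.eval 0 + P.eval 1) / 2
      + ∑ ν ∈ Finset.range n₀, gregoryCorr n₀ ν * (P.eval ((ν : ℝ) + 1) - P.eval (ν : ℝ))
      = ∫ s in (0 : ℝ)..1, P.eval s := by
  have hint : ∀ P : Polynomial ℝ, IntervalIntegrable (fun s => P.eval s) volume 0 1 :=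
    fun P => P.continuous.intervalIntegrable _ _
  let Φ : Polynomial ℝ →ₗ[ℝ] ℝ :=
    { toFun := fun P => (P.eval 0 + P.eval 1) / 2
        + ∑ ν ∈ Finset.range n₀, gregoryCorr n₀ ν * (P.eval ((ν : ℝ) + 1) - P.eval (ν : ℝ))
        - ∫ s in (0 : ℝ)..1, P.eval s
      map_add' := fun P Q => by
        simp only [Polynomial.eval_add]
        rw [intervalIntegral.integral_add (hint P) (hint Q)]
        have : ∀ ν : ℕ, gregoryCorr n₀ ν * (P.eval ((ν : ℝ) + 1) + Q.eval ((ν : ℝ) + 1)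
              - (P.eval (ν : ℝ) + Q.eval (ν : ℝ)))
            = gregoryCorr n₀ ν * (P.eval ((ν : ℝ) + 1) - P.eval (ν : ℝ))
              + gregoryCorr n₀ ν * (Q.eval ((ν : ℝ) + 1) - Q.eval (ν : ℝ)) := fun ν => by ring
        simp only [this, Finset.sum_add_distrib]
        ring
      map_smul' := fun r P => by
        simp only [Polynomial.eval_smul, smul_eq_mul, RingHom.id_apply,
          intervalIntegral.integral_const_mul, mul_sub, mul_add, Finset.mul_sum]
        simp only [mul_left_comm r]
        ring }
  have h := Polynomial.eq_zero_of_descPochhammer Φ n₀ (fun m hm => ?_) P hP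
  · exact sub_eq_zero.1 h
  · change _ + _ - _ = (0 : ℝ)
    rw [integral_descPochhammer]
    have e0 := descPochhammer_eval_real_nat m 0
    have e1 := descPochhammer_eval_real_nat m 1
    have e2 : ∀ ν : ℕ, (descPochhammer ℝ m).eval ((ν : ℝ) + 1)
        = (m.factorial : ℝ) * ((ν + 1).choose m : ℝ) := fun ν => by
      rw [← descPochhammer_eval_real_nat]; push_cast; rfl
    rw [Nat.cast_zero] at e0
    rw [Nat.cast_one] at e1
    simp only [e0, e1, e2, descPochhammer_eval_real_nat, ← mul_sub]
    simp only [mul_left_comm _ (m.factorial : ℝ)]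
    rw [← Finset.mul_sum, sum_gregoryCorr_mul_choose hn₀ m hm]
    rcases m with _ | _ | m
    · simp [gregoryCoeff_zero]
    · simp [gregoryCoeff_one]
    · simp [Nat.choose_eq_zero_of_lt]

/-- The corrections at the two ends cancel for degree `< n₀`. -/
lemma gregoryCorr_symm_eq_zero {n₀ : ℕ} (hn₀ : 1 ≤ n₀) (P : Polynomial ℝ)
    (hP : P.natDegree ≤ n₀ - 1) :
    ∑ ν ∈ Finset.range n₀, gregoryCorr n₀ ν * (P.eval (ν : ℝ) + P.eval (-(ν : ℝ))) = 0 := by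
  have shift : ∀ Q : Polynomial ℝ, Q.natDegree ≤ n₀ →
      ∑ ν ∈ Finset.range n₀, gregoryCorr n₀ ν *
        ((Q.eval ((ν : ℝ) + 1) - Q.eval (ν : ℝ)) + (Q.eval (-(ν : ℝ) + 1) - Q.eval (-(ν : ℝ))))
        = 0 := by
    intro Q hQ
    have h1 := gregory_step_exact hn₀ Q hQ
    have hdeg : (Q.comp (1 - Polynomial.X)).natDegree ≤ n₀ := by
      have : (1 - Polynomial.X : Polynomial ℝ).natDegree ≤ 1 := by
        compute_degree
      calc _ ≤ Q.natDegree * _ := Polynomial.natDegree_comp_le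
        _ ≤ Q.natDegree * 1 := Nat.mul_le_mul_left _ this
        _ ≤ n₀ := by omega
    have h2 := gregory_step_exact hn₀ (Q.comp (1 - Polynomial.X)) hdeg
    simp only [Polynomial.eval_comp, Polynomial.eval_sub, Polynomial.eval_one,
      Polynomial.eval_X] at h2
    rw [intervalIntegral.integral_comp_sub_left (fun s => Q.eval s) (1 : ℝ)] at h2
    have h3 : ∀ ν : ℕ, gregoryCorr n₀ ν *
        ((Q.eval ((ν : ℝ) + 1) - Q.eval (ν : ℝ)) + (Q.eval (-(ν : ℝ) + 1) - Q.eval (-(ν : ℝ))))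
        = gregoryCorr n₀ ν * (Q.eval ((ν : ℝ) + 1) - Q.eval (ν : ℝ))
          - gregoryCorr n₀ ν * (Q.eval (1 - ((ν : ℝ) + 1)) - Q.eval (1 - (ν : ℝ))) := by
      intro ν
      rw [show 1 - ((ν : ℝ) + 1) = -(ν : ℝ) by ring, show 1 - (ν : ℝ) = -(ν : ℝ) + 1 by ring]
      ring
    simp only [h3, Finset.sum_sub_distrib]
    simp only [sub_self, sub_zero] at h2
    linarith
  let Φ : Polynomial ℝ →ₗ[ℝ] ℝ :=
    { toFun := fun P =>
        ∑ ν ∈ Finset.range n₀, gregoryCorr n₀ ν * (P.eval (ν : ℝ) + P.eval (-(ν : ℝ)))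
      map_add' := fun P Q => by
        simp only [Polynomial.eval_add, ← Finset.sum_add_distrib]
        exact Finset.sum_congr rfl fun ν _ => by ring
      map_smul' := fun r P => by
        simp only [Polynomial.eval_smul, smul_eq_mul, RingHom.id_apply, Finset.mul_sum]
        exact Finset.sum_congr rfl fun ν _ => by ring }
  refine Polynomial.eq_zero_of_descPochhammer Φ (n₀ - 1) (fun m hm => ?_) P hP
  have h := shift (descPochhammer ℝ (m + 1)) (by rw [descPochhammer_natDegree]; omega)
  have hΔ : ∀ x : ℝ, (descPochhammer ℝ (m + 1)).eval (x + 1) - (descPochhammer ℝ (m + 1)).eval x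
      = ((m : ℝ) + 1) * (descPochhammer ℝ m).eval x := by
    intro x
    rw [descPochhammer_succ_eval m x, descPochhammer_succ_left]
    simp
    ring
  simp only [hΔ, ← mul_add] at h
  simp only [mul_left_comm _ ((m : ℝ) + 1)] at h
  rw [← Finset.mul_sum] at h
  exact (mul_eq_zero.1 h).resolve_left (by positivity)

lemma Polynomial.natDegree_comp_affine_le (P : Polynomial ℝ) (a b : ℝ) :
    (P.comp (Polynomial.C a + Polynomial.C b * Polynomial.X)).natDegree ≤ P.natDegree := by
  have : (Polynomial.C a + Polynomial.C b * Polynomial.X : Polynomial ℝ).natDegree ≤ 1 := by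
    compute_degree
  calc _ ≤ P.natDegree * _ := Polynomial.natDegree_comp_le
    _ ≤ P.natDegree * 1 := Nat.mul_le_mul_left _ this
    _ = P.natDegree := mul_one _

/-- The backward form of the local rule, on the cell `[a, a + h]`. -/
lemma gregory_step_exact_backward {n₀ : ℕ} (hn₀ : 1 ≤ n₀) (P : Polynomial ℝ)
    (hP : P.natDegree ≤ n₀) (a h : ℝ) :
    h * ((P.eval a + P.eval (a + h)) / 2
      - ∑ ν ∈ Finset.range n₀,
          gregoryCorr n₀ ν * (P.eval (a + (1 - (ν : ℝ)) * h) - P.eval (a - (ν : ℝ) * h)))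
      = ∫ s in a..(a + h), P.eval s := by
  have key := gregory_step_exact hn₀
    (P.comp (Polynomial.C (a + h) + Polynomial.C (-h) * Polynomial.X))
    ((P.natDegree_comp_affine_le _ _).trans hP)
  simp only [Polynomial.eval_comp, Polynomial.eval_add, Polynomial.eval_mul, Polynomial.eval_C,
    Polynomial.eval_X] at key
  have hint : h * ∫ s in (0 : ℝ)..1, P.eval (a + h + -h * s) = ∫ s in a..(a + h), P.eval s := by
    have := intervalIntegral.smul_integral_comp_add_mul (a := 0) (b := 1)
      (fun s => P.eval s) (-h) (a + h)
    rw [intervalIntegral.integral_symm (a + h) a]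
    simp only [smul_eq_mul, mul_zero, add_zero, mul_one, add_neg_cancel_right] at this
    rw [← this]; ring
  rw [← hint, ← key]
  congr 1
  rw [sub_eq_add_neg, ← Finset.sum_neg_distrib]
  congr 1
  · ring_nf
  · refine Finset.sum_congr rfl fun ν _ => ?_
    rw [show a + h + -h * ((ν : ℝ) + 1) = a - ν * h by ring,
      show a + h + -h * (ν : ℝ) = a + (1 - ν) * h by ring]
    ring

/-- The Gregory rule on `n₀ + 1` nodes is exact for degree `< n₀`. -/
lemma gregorySum_base_exact {n₀ : ℕ} (hn₀ : 1 ≤ n₀) (P : Polynomial ℝ)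
    (hP : P.natDegree ≤ n₀ - 1) (h : ℝ) :
    gregorySum n₀ h n₀ (fun k => P.eval ((k : ℝ) * h)) = ∫ s in (0 : ℝ)..((n₀ : ℝ) * h), P.eval s := by
  have key : ∀ n : ℕ, h * (∑ ν ∈ Finset.range (n + 1), P.eval ((ν : ℝ) * h)
        - (P.eval 0 + P.eval ((n : ℝ) * h)) / 2
        - ∑ ν ∈ Finset.range n₀,
            gregoryCorr n₀ ν * (P.eval ((ν : ℝ) * h) + P.eval (((n : ℝ) - ν) * h)))
      = ∫ s in (0 : ℝ)..((n : ℝ) * h), P.eval s := by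
    intro n
    induction n with
    | zero =>
      have := gregoryCorr_symm_eq_zero hn₀
        (P.comp (Polynomial.C 0 + Polynomial.C h * Polynomial.X))
        ((P.natDegree_comp_affine_le _ _).trans hP)
      simp only [Polynomial.eval_comp, Polynomial.eval_add, Polynomial.eval_mul, Polynomial.eval_C,
        Polynomial.eval_X, zero_add] at this
      simp only [mul_comm h, neg_mul] at this
      simp [this]
    | succ n ih =>
      have hs := gregory_step_exact_backward hn₀ P (hP.trans (Nat.sub_le _ _)) ((n : ℝ) * h) h
      rw [show (((n + 1 : ℕ) : ℝ)) * h = (n : ℝ) * h + h by push_cast; ring,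
        ← intervalIntegral.integral_add_adjacent_intervals
          (P.continuous.intervalIntegrable _ ((n : ℝ) * h))
          (P.continuous.intervalIntegrable _ _), ← hs, ← ih, Finset.sum_range_succ _ (n + 1)]
      have e1 : ∀ ν : ℕ, (((n + 1 : ℕ) : ℝ) - ν) * h = (n : ℝ) * h + (1 - (ν : ℝ)) * h := by
        intro ν; push_cast; ring
      have e2 : ∀ ν : ℕ, ((n : ℝ) - ν) * h = (n : ℝ) * h - (ν : ℝ) * h := by
        intro ν; ring
      have e3 : (((n + 1 : ℕ) : ℝ)) * h = (n : ℝ) * h + h := by push_cast; ring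
      simp only [e1, e2, e3, mul_add, mul_sub, Finset.sum_add_distrib, Finset.sum_sub_distrib]
      ring
  rw [gregorySum_eq hn₀ le_rfl, ← key n₀]
  congr 2
  · simp
  · refine Finset.sum_congr rfl fun ν hν => ?_
    rw [Nat.cast_sub (Finset.mem_range.1 hν).le]

/-- `g` is approximated on `[x₀, b]` to order `d + 1` at each `x₀ ∈ [0, b]` by a polynomial of
degree `≤ d`. -/
def PolyApprox (d : ℕ) (M b : ℝ) (g : ℝ → ℝ) : Prop :=
  ∀ x₀ ∈ Icc 0 b, ∃ P : Polynomial ℝ, P.natDegree ≤ d ∧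
    ∀ y ∈ Icc x₀ b, |g y - P.eval y| ≤ M * (y - x₀) ^ (d + 1)

lemma abs_integral_sub_le {g p : ℝ → ℝ} {a b ε : ℝ} (hab : a ≤ b)
    (hg : IntervalIntegrable g volume a b) (hp : IntervalIntegrable p volume a b)
    (h : ∀ y ∈ Icc a b, |g y - p y| ≤ ε) :
    |(∫ s in a..b, g s) - ∫ s in a..b, p s| ≤ (b - a) * ε := by
  rw [← intervalIntegral.integral_sub hg hp]
  have := intervalIntegral.norm_integral_le_of_norm_le_const (a := a) (b := b)
    (f := fun s => g s - p s) (C := ε) fun y hy => by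
      rw [uIoc_of_le hab] at hy
      exact h y ⟨hy.1.le, hy.2⟩
  rwa [abs_of_nonneg (sub_nonneg.2 hab), mul_comm] at this

/-- The constant in the error bound for the Gregory rule. -/
def gregoryErrorConst (n₀ : ℕ) : ℝ :=
  (gregoryWeightBound n₀ * (2 * n₀) + n₀) * (n₀ : ℝ) ^ n₀
    + gregoryWeightBound n₀ * (n₀ : ℝ) ^ (n₀ + 1)

lemma gregoryErrorConst_nonneg (n₀ : ℕ) : 0 ≤ gregoryErrorConst n₀ := by
  have := gregoryWeightBound_nonneg n₀
  unfold gregoryErrorConst; positivity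

lemma gregorySum_base_error {n₀ : ℕ} (hn₀ : 1 ≤ n₀) {h b M : ℝ} (hh : 0 ≤ h) {g : ℝ → ℝ}
    (hg : ContinuousOn g (Icc 0 b)) (hb : (n₀ : ℝ) * h ≤ b) (hM : 0 ≤ M)
    (happ : PolyApprox (n₀ - 1) M b g) :
    |(∫ s in (0 : ℝ)..((n₀ : ℝ) * h), g s) - gregorySum n₀ h n₀ (fun k => g ((k : ℝ) * h))|
      ≤ (gregoryWeightBound n₀ * (2 * n₀) + n₀) * (n₀ : ℝ) ^ n₀ * M * h ^ (n₀ + 1) := by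
  have h0 : 0 ≤ (n₀ : ℝ) * h := by positivity
  obtain ⟨P, hP, hgP⟩ := happ 0 ⟨le_rfl, h0.trans hb⟩
  have hε : ∀ y ∈ Icc 0 ((n₀ : ℝ) * h), |g y - P.eval y| ≤ M * ((n₀ : ℝ) * h) ^ n₀ := by
    intro y hy
    refine (hgP y ⟨hy.1, hy.2.trans hb⟩).trans ?_
    rw [Nat.sub_add_cancel hn₀, sub_zero]
    exact mul_le_mul_of_nonneg_left (pow_le_pow_left₀ hy.1 hy.2 _) hM
  have hgint : IntervalIntegrable g volume 0 ((n₀ : ℝ) * h) :=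
    (hg.mono (Icc_subset_Icc le_rfl hb)).intervalIntegrable_of_Icc h0
  have h1 := abs_integral_sub_le h0 hgint (P.continuous.intervalIntegrable _ _) hε
  have h2 : |gregorySum n₀ h n₀ (fun k => P.eval ((k : ℝ) * h))
      - gregorySum n₀ h n₀ (fun k => g ((k : ℝ) * h))|
      ≤ gregoryWeightBound n₀ * (2 * ((n₀ : ℝ) * h) * (M * ((n₀ : ℝ) * h) ^ n₀)) := by
    rw [gregorySum_sub]
    refine abs_gregorySum_le_of_bound hn₀ le_rfl hh le_rfl (by positivity) fun ν hν => ?_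
    rw [abs_sub_comm]
    refine hε _ ⟨by positivity, mul_le_mul_of_nonneg_right (by exact_mod_cast hν) hh⟩
  rw [gregorySum_base_exact hn₀ P hP h] at h2
  refine (abs_sub_le _ _ _).trans ((add_le_add h1 h2).trans (le_of_eq ?_))
  rw [mul_pow]; ring

lemma gregorySum_succ_sub {n₀ n : ℕ} (hn₀ : 1 ≤ n₀) (hn : n₀ ≤ n) (h : ℝ) (g : ℕ → ℝ) :
    gregorySum n₀ h (n + 1) g - gregorySum n₀ h n g
      = h * ((g n + g (n + 1)) / 2
        - ∑ ν ∈ Finset.range n₀, gregoryCorr n₀ ν * (g (n + 1 - ν) - g (n - ν))) := by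
  rw [gregorySum_eq hn₀ hn, gregorySum_eq hn₀ (hn.trans (Nat.le_succ n)),
    Finset.sum_range_succ _ (n + 1)]
  simp only [mul_add, mul_sub, Finset.sum_add_distrib, Finset.sum_sub_distrib]
  ring

lemma gregorySum_step_error {n₀ n : ℕ} (hn₀ : 1 ≤ n₀) (hn : n₀ ≤ n) {h b M : ℝ} (hh : 0 ≤ h)
    {g : ℝ → ℝ} (hg : ContinuousOn g (Icc 0 b)) (hb : ((n + 1 : ℕ) : ℝ) * h ≤ b) (hM : 0 ≤ M)
    (happ : PolyApprox n₀ M b g) :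
    |(∫ s in ((n : ℝ) * h)..(((n + 1 : ℕ) : ℝ) * h), g s)
        - (gregorySum n₀ h (n + 1) (fun k => g ((k : ℝ) * h))
          - gregorySum n₀ h n (fun k => g ((k : ℝ) * h)))|
      ≤ gregoryWeightBound n₀ * (n₀ : ℝ) ^ (n₀ + 1) * M * h * h ^ (n₀ + 1) := by
  set x₀ : ℝ := ((n + 1 - n₀ : ℕ) : ℝ) * h with hx₀
  have hx₀' : x₀ = ((n + 1 : ℕ) : ℝ) * h - n₀ * h := by
    rw [hx₀, Nat.cast_sub (by omega)]; ring
  have hx0 : 0 ≤ x₀ := by positivity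
  have hx1 : x₀ ≤ ((n + 1 : ℕ) : ℝ) * h := by
    rw [hx₀']; have : 0 ≤ (n₀ : ℝ) * h := by positivity
    linarith
  obtain ⟨P, hP, hgP⟩ := happ x₀ ⟨hx0, hx1.trans hb⟩
  set ε := M * ((n₀ : ℝ) * h) ^ (n₀ + 1) with hεdef
  have hε : ∀ y ∈ Icc x₀ (((n + 1 : ℕ) : ℝ) * h), |g y - P.eval y| ≤ ε := by
    intro y hy
    refine (hgP y ⟨hy.1, hy.2.trans hb⟩).trans ?_
    refine mul_le_mul_of_nonneg_left (pow_le_pow_left₀ (by linarith [hy.1]) ?_ _) hM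
    linarith [hy.2]
  have hnode : ∀ k : ℕ, n + 1 - n₀ ≤ k → k ≤ n + 1 →
      |g ((k : ℝ) * h) - P.eval ((k : ℝ) * h)| ≤ ε := fun k hk hk' =>
    hε _ ⟨mul_le_mul_of_nonneg_right (by exact_mod_cast hk) hh,
      mul_le_mul_of_nonneg_right (by exact_mod_cast hk') hh⟩
  have hstep : (((n + 1 : ℕ) : ℝ)) * h = (n : ℝ) * h + h := by push_cast; ring
  have hle : (n : ℝ) * h ≤ (((n + 1 : ℕ) : ℝ)) * h := by rw [hstep]; linarith
  have hxn : x₀ ≤ (n : ℝ) * h := by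
    refine mul_le_mul_of_nonneg_right ?_ hh
    exact_mod_cast (show n + 1 - n₀ ≤ n by omega)
  have hgint : IntervalIntegrable g volume ((n : ℝ) * h) (((n + 1 : ℕ) : ℝ) * h) :=
    (hg.mono (Icc_subset_Icc (by positivity) hb)).intervalIntegrable_of_Icc hle
  have h1 := abs_integral_sub_le hle hgint (P.continuous.intervalIntegrable _ _)
    fun y hy => hε y ⟨hxn.trans hy.1, hy.2⟩
  have hexact : (∫ s in ((n : ℝ) * h)..(((n + 1 : ℕ) : ℝ) * h), P.eval s)
      = gregorySum n₀ h (n + 1) (fun k => P.eval ((k : ℝ) * h))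
        - gregorySum n₀ h n (fun k => P.eval ((k : ℝ) * h)) := by
    rw [gregorySum_succ_sub hn₀ hn, hstep, ← gregory_step_exact_backward hn₀ P hP]
    congr 2
    refine Finset.sum_congr rfl fun ν hν => ?_
    rw [Finset.mem_range] at hν
    rw [Nat.cast_sub (show ν ≤ n + 1 by omega), Nat.cast_sub (show ν ≤ n by omega)]
    push_cast
    ring_nf
  have h2 : |(gregorySum n₀ h (n + 1) (fun k => P.eval ((k : ℝ) * h))
        - gregorySum n₀ h n (fun k => P.eval ((k : ℝ) * h)))
      - (gregorySum n₀ h (n + 1) (fun k => g ((k : ℝ) * h))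
        - gregorySum n₀ h n (fun k => g ((k : ℝ) * h)))|
      ≤ h * (ε + 2 * (∑ ν ∈ Finset.range n₀, |gregoryCorr n₀ ν|) * ε) := by
    rw [gregorySum_succ_sub hn₀ hn, gregorySum_succ_sub hn₀ hn, ← mul_sub, abs_mul,
      abs_of_nonneg hh]
    refine mul_le_mul_of_nonneg_left ?_ hh
    rw [sub_sub_sub_comm, ← Finset.sum_sub_distrib]
    refine (abs_sub _ _).trans (add_le_add ?_ ?_)
    · have a1 := abs_le.1 (hnode n (by omega) (by omega))
      have a2 := abs_le.1 (hnode (n + 1) (by omega) (by omega))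
      rw [abs_le]; constructor <;> linarith [a1.1, a1.2, a2.1, a2.2]
    · refine (Finset.abs_sum_le_sum_abs _ _).trans ?_
      rw [Finset.mul_sum, Finset.sum_mul]
      refine Finset.sum_le_sum fun ν hν => ?_
      rw [Finset.mem_range] at hν
      rw [← mul_sub, abs_mul, mul_comm 2, mul_assoc]
      refine mul_le_mul_of_nonneg_left ?_ (abs_nonneg _)
      have a1 := abs_le.1 (hnode (n + 1 - ν) (by omega) (by omega))
      have a2 := abs_le.1 (hnode (n - ν) (by omega) (by omega))
      rw [abs_le]; constructor <;> linarith [a1.1, a1.2, a2.1, a2.2]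
  rw [← hexact] at h2
  refine (abs_sub_le _ _ _).trans ((add_le_add h1 h2).trans ?_)
  have hε0 : 0 ≤ ε := by positivity
  have e : (((n + 1 : ℕ) : ℝ)) * h - (n : ℝ) * h = h := by rw [hstep]; ring
  rw [e]
  calc h * ε + h * (ε + 2 * (∑ ν ∈ Finset.range n₀, |gregoryCorr n₀ ν|) * ε)
      ≤ gregoryWeightBound n₀ * (h * ε) := by
        unfold gregoryWeightBound
        nlinarith [mul_nonneg hh hε0]
    _ = _ := by rw [hεdef, mul_pow]; ring

/-- The `(n₀-1)`-th Gregory rule is of order `n₀ + 1`, uniformly in the number of nodes. -/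
theorem gregorySum_error {n₀ n : ℕ} (hn₀ : 1 ≤ n₀) (hn : n₀ ≤ n) {h b M : ℝ} (hh : 0 ≤ h)
    {g : ℝ → ℝ} (hg : ContinuousOn g (Icc 0 b)) (hb : (n : ℝ) * h ≤ b) (hM : 0 ≤ M)
    (happ : PolyApprox n₀ M b g) (happ' : PolyApprox (n₀ - 1) M b g) :
    |(∫ s in (0 : ℝ)..((n : ℝ) * h), g s) - gregorySum n₀ h n (fun k => g ((k : ℝ) * h))|
      ≤ gregoryErrorConst n₀ * M * (1 + b) * h ^ (n₀ + 1) := by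
  have hW := gregoryWeightBound_nonneg n₀
  have hb0 : 0 ≤ b := le_trans (by positivity) hb
  set A := (gregoryWeightBound n₀ * (2 * n₀) + n₀) * (n₀ : ℝ) ^ n₀ with hA
  set B := gregoryWeightBound n₀ * (n₀ : ℝ) ^ (n₀ + 1) with hB
  have hA0 : 0 ≤ A := by positivity
  have hB0 : 0 ≤ B := by positivity
  have key : |(∫ s in (0 : ℝ)..((n : ℝ) * h), g s) - gregorySum n₀ h n (fun k => g ((k : ℝ) * h))|
      ≤ (A + B * ((n : ℝ) * h)) * M * h ^ (n₀ + 1) := by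
    induction n, hn using Nat.le_induction with
    | base =>
      refine (gregorySum_base_error hn₀ hh hg hb hM happ').trans ?_
      refine mul_le_mul_of_nonneg_right (mul_le_mul_of_nonneg_right ?_ hM) (by positivity)
      have : 0 ≤ B * ((n₀ : ℝ) * h) := by positivity
      linarith
    | succ n hn ih =>
      have hle : (n : ℝ) * h ≤ (((n + 1 : ℕ) : ℝ)) * h :=
        mul_le_mul_of_nonneg_right (by exact_mod_cast Nat.le_succ n) hh
      have h1 := ih (hle.trans hb)
      have h2 := gregorySum_step_error hn₀ hn hh hg hb hM happ
      rw [← intervalIntegral.integral_add_adjacent_intervals (b := (n : ℝ) * h)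
        ((hg.mono (Icc_subset_Icc le_rfl (hle.trans hb))).intervalIntegrable_of_Icc (by positivity))
        ((hg.mono (Icc_subset_Icc (by positivity) hb)).intervalIntegrable_of_Icc hle)]
      have e : ∀ x y p q : ℝ, x + y - p = (x - q) + (y - (p - q)) := fun _ _ _ _ => by ring
      rw [e _ _ _ (gregorySum n₀ h n (fun k => g ((k : ℝ) * h)))]
      refine (abs_add_le _ _).trans ((add_le_add h1 h2).trans (le_of_eq ?_))
      push_cast
      rw [hB]; ring
  refine key.trans (mul_le_mul_of_nonneg_right ?_ (by positivity))
  have h1 : A + B * ((n : ℝ) * h) ≤ (A + B) * (1 + b) := by nlinarith [mul_nonneg hA0 hb0]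
  calc (A + B * ((n : ℝ) * h)) * M ≤ ((A + B) * (1 + b)) * M := mul_le_mul_of_nonneg_right h1 hM
    _ = _ := by rw [gregoryErrorConst]; ring

/-- A `C^p` function on a convex set of reals that is a retract extends to a `C^p` function. -/
theorem exists_contDiff_eqOn_of_retract {s : Set ℝ} (hs : UniqueDiffOn ℝ s) (hconv : Convex ℝ s)
    {r : ℝ → ℝ} (hr : Continuous r) (hrs : ∀ x, r x ∈ s) (hr' : ∀ x ∈ s, r x = x) (p : ℕ)
    {f : ℝ → ℝ} (hf : ContDiffOn ℝ p f s) : ∃ F : ℝ → ℝ, ContDiff ℝ p F ∧ EqOn F f s := by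
  induction p generalizing f with
  | zero =>
    refine ⟨f ∘ r, ?_, fun x hx => by simp [hr' x hx]⟩
    rw [Nat.cast_zero, contDiff_zero]
    exact hf.continuousOn.comp_continuous hr hrs
  | succ p ih =>
    rw [Nat.cast_succ, contDiffOn_succ_iff_derivWithin hs] at hf
    obtain ⟨hd, -, hf'⟩ := hf
    obtain ⟨F', hF', hEq⟩ := ih hf'
    have hder : ∀ x, HasDerivAt (fun x => f (r 0) + ∫ y in r 0..x, F' y) (F' x) x := fun x =>
      (intervalIntegral.integral_hasDerivAt_right (hF'.continuous.intervalIntegrable _ _)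
        hF'.continuous.stronglyMeasurable.stronglyMeasurableAtFilter
        hF'.continuous.continuousAt).const_add _
    refine ⟨fun x => f (r 0) + ∫ y in r 0..x, F' y, ?_, fun x hx => ?_⟩
    · rw [Nat.cast_succ, contDiff_succ_iff_deriv]
      refine ⟨fun x => (hder x).differentiableAt, by simp, ?_⟩
      rwa [show deriv (fun x => f (r 0) + ∫ y in r 0..x, F' y) = F' from
        funext fun x => (hder x).deriv]
    · have hsub : ∀ x ∈ s, HasDerivWithinAt
          (fun x => (f (r 0) + ∫ y in r 0..x, F' y) - f x) 0 s x := by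
        intro x hx
        have := (hder x).hasDerivWithinAt (s := s) |>.sub (hd x hx).hasDerivWithinAt
        rwa [hEq hx, sub_self] at this
      have hconst := hconv.is_const_of_fderivWithin_eq_zero (𝕜 := ℝ)
        (fun x hx => (hsub x hx).differentiableWithinAt)
        (fun x hx => by
          have h := (hsub x hx).hasFDerivWithinAt.fderivWithin (hs x hx)
          rw [h]; ext; simp) hx (hrs 0)
      simp only [intervalIntegral.integral_same, add_zero, sub_self] at hconst
      exact sub_eq_zero.1 hconst

theorem ContDiffOn.exists_contDiff_eqOn_Icc {a b : ℝ} (hab : a < b) {p : ℕ} {f : ℝ → ℝ}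
    (hf : ContDiffOn ℝ p f (Icc a b)) : ∃ F : ℝ → ℝ, ContDiff ℝ p F ∧ EqOn F f (Icc a b) :=
  exists_contDiff_eqOn_of_retract (uniqueDiffOn_Icc hab) (convex_Icc a b)
    (r := fun x => (projIcc a b hab.le x : ℝ)) (by fun_prop)
    (fun x => (projIcc a b hab.le x).2) (fun x hx => by rw [projIcc_of_mem hab.le hx]) p hf

theorem ContDiffOn.exists_contDiff_eqOn_Ici {a : ℝ} {p : ℕ} {f : ℝ → ℝ}
    (hf : ContDiffOn ℝ p f (Ici a)) : ∃ F : ℝ → ℝ, ContDiff ℝ p F ∧ EqOn F f (Ici a) :=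
  exists_contDiff_eqOn_of_retract (uniqueDiffOn_Ici a) (convex_Ici a)
    (r := fun x => max a x) (by fun_prop) (fun x => mem_Ici.2 (le_max_left a x))
    (fun x hx => max_eq_right hx) p hf

section Primitive

variable {E : Type*} [NormedAddCommGroup E] [NormedSpace ℝ E] [FiniteDimensional ℝ E]

lemma hasFDerivAt_parametric_intervalIntegral {G : E × ℝ → ℝ} {G' : E × ℝ → E →L[ℝ] ℝ}
    (hG : Continuous G) (hG' : Continuous G')
    (h : ∀ z s, HasFDerivAt (fun z => G (z, s)) (G' (z, s)) z) (a b : ℝ) (z : E) :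
    HasFDerivAt (fun z => ∫ s in a..b, G (z, s)) (∫ s in a..b, G' (z, s)) z := by
  have : ProperSpace E := FiniteDimensional.proper ℝ E
  obtain ⟨C, hC⟩ := ((isCompact_closedBall z 1).prod (isCompact_uIcc (a := a) (b := b))
    ).exists_bound_of_continuousOn hG'.continuousOn
  refine intervalIntegral.hasFDerivAt_integral_of_dominated_of_fderiv_le
    (F := fun z s => G (z, s)) (F' := fun z s => G' (z, s)) (bound := fun _ => C)
    (Metric.closedBall_mem_nhds z one_pos) ?_ ?_ ?_ ?_ ?_ ?_
  · exact Filter.Eventually.of_forall fun w =>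
      (show Continuous fun s => G (w, s) by fun_prop).aestronglyMeasurable
  · exact (show Continuous fun s => G (z, s) by fun_prop).intervalIntegrable _ _
  · exact (show Continuous fun s => G' (z, s) by fun_prop).aestronglyMeasurable
  · exact Filter.Eventually.of_forall fun s hs w hw => hC (w, s) ⟨hw, uIoc_subset_uIcc hs⟩
  · exact intervalIntegrable_const
  · exact Filter.Eventually.of_forall fun s _ w _ => h w s

lemma hasFDerivAt_parametric_primitive {G : E × ℝ → ℝ} {G' : E × ℝ → E →L[ℝ] ℝ}
    (hG : Continuous G) (hG' : Continuous G')
    (h : ∀ z s, HasFDerivAt (fun z => G (z, s)) (G' (z, s)) z) (a : ℝ) (q : E × ℝ) :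
    HasFDerivAt (fun q : E × ℝ => ∫ s in a..q.2, G (q.1, s))
      ((∫ s in a..q.2, G' (q.1, s)).coprod (ContinuousLinearMap.toSpanSingleton ℝ (G q))) q := by
  refine (hasStrictFDerivAt_uncurry_coprod (𝕜 := ℝ) (u := q)
    (f := fun z t => ∫ s in a..t, G (z, s)) (f₁ := fun z t => ∫ s in a..t, G' (z, s))
    (f₂ := fun z t => ContinuousLinearMap.toSpanSingleton ℝ (G (z, t)))
    (Filter.Eventually.of_forall fun v => ?_) (Filter.Eventually.of_forall fun v => ?_)
    ?_ ?_).hasFDerivAt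
  · exact hasFDerivAt_parametric_intervalIntegral hG hG' h a v.2 v.1
  · have hc : Continuous fun s => G (v.1, s) := by fun_prop
    exact (intervalIntegral.integral_hasDerivAt_right (hc.intervalIntegrable _ _)
      hc.stronglyMeasurable.stronglyMeasurableAtFilter hc.continuousAt).hasFDerivAt
  · exact (intervalIntegral.continuous_parametric_intervalIntegral_of_continuous
      (f := fun (q : E × ℝ) s => G' (q.1, s)) (by fun_prop) continuous_snd).continuousAt
  · exact (show Continuous fun v : E × ℝ => ContinuousLinearMap.toSpanSingleton ℝ (G (v.1, v.2)) from
      (ContinuousLinearMap.toSpanSingletonCLE (𝕜 := ℝ) (E := ℝ)).continuous.comp hG).continuousAt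

lemma contDiff_parametric_primitive_aux {k : ℕ}
    (ih : ∀ G : E × ℝ → ℝ, ContDiff ℝ k G → ∀ a : ℝ,
      ContDiff ℝ k (fun q : E × ℝ => ∫ s in a..q.2, G (q.1, s)))
    {G : E × ℝ → ℝ} {G' : E × ℝ → E →L[ℝ] ℝ} (hG : ContDiff ℝ k G) (hG' : ContDiff ℝ k G')
    (h : ∀ z s, HasFDerivAt (fun z => G (z, s)) (G' (z, s)) z) (a : ℝ) :
    ContDiff ℝ (k + 1 : ℕ) (fun q : E × ℝ => ∫ s in a..q.2, G (q.1, s)) := by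
  rw [Nat.cast_succ, contDiff_succ_iff_hasFDerivAt]
  refine ⟨_, ?_, hasFDerivAt_parametric_primitive hG.continuous hG'.continuous h a⟩
  rw [contDiff_clm_apply_iff]
  rintro ⟨y, τ⟩
  have hint : ∀ q : E × ℝ, (∫ s in a..q.2, G' (q.1, s)) y = ∫ s in a..q.2, G' (q.1, s) y := by
    intro q
    refine ContinuousLinearMap.intervalIntegral_apply ?_ y
    exact (hG'.continuous.comp (by fun_prop : Continuous fun s : ℝ => (q.1, s))).intervalIntegrable
      _ _
  simp only [ContinuousLinearMap.coprod_apply, hint, ContinuousLinearMap.toSpanSingleton_apply,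
    smul_eq_mul]
  exact (ih _ (hG'.clm_apply contDiff_const) a).add (contDiff_const.mul hG)

theorem contDiff_parametric_primitive (k : ℕ) (G : E × ℝ → ℝ) (hG : ContDiff ℝ k G) (a : ℝ) :
    ContDiff ℝ k (fun q : E × ℝ => ∫ s in a..q.2, G (q.1, s)) := by
  induction k generalizing G a with
  | zero =>
    rw [Nat.cast_zero, contDiff_zero] at hG ⊢
    exact intervalIntegral.continuous_parametric_intervalIntegral_of_continuous
      (f := fun (q : E × ℝ) s => G (q.1, s)) (by fun_prop) continuous_snd
  | succ k ih =>
    have hG0 := hG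
    rw [Nat.cast_succ, contDiff_succ_iff_fderiv] at hG
    refine contDiff_parametric_primitive_aux ih
      (G' := fun q => (fderiv ℝ G q).comp (ContinuousLinearMap.inl ℝ E ℝ))
      (hG0.of_le (by exact_mod_cast Nat.le_succ k)) (hG.2.2.clm_comp contDiff_const)
      (fun z s => ?_) a
    have h1 := (hG.1 (z, s)).hasFDerivAt
    exact h1.comp z (hasFDerivAt_prodMk_left z s)

/-- A parametric primitive gains a derivative if the parameter derivative of the integrand is as
smooth as the integrand. -/
theorem contDiff_succ_parametric_primitive {k : ℕ} {G : E × ℝ → ℝ} {G' : E × ℝ → E →L[ℝ] ℝ}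
    (hG : ContDiff ℝ k G) (hG' : ContDiff ℝ k G')
    (h : ∀ z s, HasFDerivAt (fun z => G (z, s)) (G' (z, s)) z) (a : ℝ) :
    ContDiff ℝ (k + 1 : ℕ) (fun q : E × ℝ => ∫ s in a..q.2, G (q.1, s)) :=
  contDiff_parametric_primitive_aux (contDiff_parametric_primitive k) hG hG' h a

end Primitive

section Taylor

variable {E : Type*} [NormedAddCommGroup E] [NormedSpace ℝ E]

lemma continuous_iteratedDeriv_section (p : ℕ) (G : E × ℝ → ℝ) (hG : ContDiff ℝ p G) :
    Continuous fun q : E × ℝ => iteratedDeriv p (fun s => G (q.1, s)) q.2 := by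
  induction p generalizing G with
  | zero => simpa using hG.continuous
  | succ p ih =>
    rw [Nat.cast_succ, contDiff_succ_iff_fderiv] at hG
    have hd : ∀ z, deriv (fun s => G (z, s)) = fun s => fderiv ℝ G (z, s) (0, 1) := by
      intro z; ext s
      have h1 := (hG.1 (z, s)).hasFDerivAt.comp_hasDerivAt s
        ((hasDerivAt_const s z).prodMk (hasDerivAt_id s))
      exact h1.deriv
    simp only [iteratedDeriv_succ', hd]
    exact ih (fun q => fderiv ℝ G q (0, 1)) (hG.2.2.clm_apply contDiff_const)

lemma exists_polynomial_eq_taylorWithinEval (f : ℝ → ℝ) (n : ℕ) (s : Set ℝ) (x₀ : ℝ) :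
    ∃ P : Polynomial ℝ, P.natDegree ≤ n ∧ ∀ y, taylorWithinEval f n s x₀ y = P.eval y := by
  refine ⟨∑ k ∈ Finset.range (n + 1), Polynomial.C (((k.factorial : ℝ)⁻¹)
    * iteratedDerivWithin k f s x₀) * (Polynomial.X - Polynomial.C x₀) ^ k, ?_, fun y => ?_⟩
  · refine Polynomial.natDegree_sum_le_of_forall_le _ _ fun k hk => ?_
    rw [Finset.mem_range] at hk
    refine (Polynomial.natDegree_C_mul_le _ _).trans (Polynomial.natDegree_pow_le.trans ?_)
    rw [Polynomial.natDegree_X_sub_C]; omega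
  · rw [taylor_within_apply, Polynomial.eval_finsetSum]
    refine Finset.sum_congr rfl fun k _ => ?_
    simp; ring

/-- Sections of a `C^{d+1}` function over a compact set of parameters are uniformly approximated by
polynomials of degree `≤ d`. -/
theorem exists_polyApprox_of_contDiff {d : ℕ} {G : E × ℝ → ℝ} (hG : ContDiff ℝ (d + 1 : ℕ) G)
    {K : Set E} (hK : IsCompact K) (b : ℝ) :
    ∃ M : ℝ, 0 ≤ M ∧ ∀ z ∈ K, PolyApprox d M b (fun s => G (z, s)) := by
  obtain ⟨C, hC⟩ := (hK.prod (isCompact_Icc (a := (0 : ℝ)) (b := b))).exists_bound_of_continuousOn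
    (continuous_iteratedDeriv_section (d + 1) G hG).continuousOn
  refine ⟨max C 0, le_max_right _ _, fun z hz x₀ hx₀ => ?_⟩
  have hg : ContDiff ℝ (d + 1 : ℕ) fun s => G (z, s) := hG.comp (by fun_prop)
  obtain ⟨P, hP, hPe⟩ := exists_polynomial_eq_taylorWithinEval (fun s => G (z, s)) d (Icc x₀ b) x₀
  refine ⟨P, hP, fun y hy => ?_⟩
  rcases hx₀.2.eq_or_lt with rfl | hlt
  · obtain rfl : y = x₀ := le_antisymm hy.2 hy.1
    rw [← hPe, taylorWithinEval_self]; simp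
  have h1 := taylor_mean_remainder_bound (n := d) hlt.le (C := max C 0)
    (by exact_mod_cast hg.contDiffOn) hy (fun w hw => by
      rw [iteratedDerivWithin_eq_iteratedDeriv (uniqueDiffOn_Icc hlt) hg.contDiffAt hw]
      exact (hC (z, w) ⟨hz, hx₀.1.trans hw.1, hw.2⟩).trans (le_max_left _ _))
  rw [hPe] at h1
  refine h1.trans (div_le_self ?_ (by exact_mod_cast Nat.factorial_pos d))
  exact mul_nonneg (le_max_right _ _) (pow_nonneg (sub_nonneg.2 hy.1) _)

/-- Uniform error bound for the Gregory rule applied to sections of a `C^{n₀+1}` function. -/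
theorem exists_gregorySum_error_bound {n₀ : ℕ} (hn₀ : 1 ≤ n₀) {G : E × ℝ → ℝ}
    (hG : ContDiff ℝ (n₀ + 1 : ℕ) G) {K : Set E} (hK : IsCompact K) {b : ℝ} (hb : 0 ≤ b) :
    ∃ A : ℝ, 0 ≤ A ∧ ∀ z ∈ K, ∀ n : ℕ, n₀ ≤ n → ∀ h : ℝ, 0 ≤ h → (n : ℝ) * h ≤ b →
      |(∫ s in (0 : ℝ)..((n : ℝ) * h), G (z, s))
        - gregorySum n₀ h n (fun k => G (z, (k : ℝ) * h))| ≤ A * h ^ (n₀ + 1) := by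
  obtain ⟨M, hM, h1⟩ := exists_polyApprox_of_contDiff hG hK b
  obtain ⟨M', hM', h2⟩ := exists_polyApprox_of_contDiff (d := n₀ - 1)
    (hG.of_le (by exact_mod_cast (by omega : n₀ - 1 + 1 ≤ n₀ + 1))) hK b
  have mono : ∀ {d : ℕ} {M N : ℝ} {g : ℝ → ℝ}, M ≤ N → PolyApprox d M b g → PolyApprox d N b g := by
    intro d M N g hMN h x₀ hx₀
    obtain ⟨P, hP, h⟩ := h x₀ hx₀
    exact ⟨P, hP, fun y hy => (h y hy).trans
      (mul_le_mul_of_nonneg_right hMN (pow_nonneg (sub_nonneg.2 hy.1) _))⟩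
  have hc : ∀ z, Continuous fun s => G (z, s) := fun z => hG.continuous.comp (by fun_prop)
  have hC := gregoryErrorConst_nonneg n₀
  refine ⟨gregoryErrorConst n₀ * max M M' * (1 + b),
    mul_nonneg (mul_nonneg hC (hM.trans (le_max_left _ _))) (by linarith),
    fun z hz n hn h hh hnh => ?_⟩
  exact gregorySum_error hn₀ hn hh (hc z).continuousOn hnh (hM.trans (le_max_left _ _))
    (mono (le_max_left _ _) (h1 z hz)) (mono (le_max_right _ _) (h2 z hz))

end Taylor

lemma contDiff_spaceIntegral {k : ℕ} {u : ℝ × ℝ → ℝ} (hu : ContDiff ℝ k u) :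
    ContDiff ℝ k fun q : ℝ × ℝ => ∫ ξ in (0 : ℝ)..q.1, u (ξ, q.2) :=
  (contDiff_parametric_primitive k (fun q : ℝ × ℝ => u (q.2, q.1))
    (hu.comp (contDiff_snd.prodMk contDiff_fst)) 0).comp (contDiff_snd.prodMk contDiff_fst)

lemma contDiff_intervalIntegral_right {E : Type*} [NormedAddCommGroup E] [NormedSpace ℝ E]
    [FiniteDimensional ℝ E] {k : ℕ} {ψ : E × ℝ → ℝ} (hψ : ContDiff ℝ k ψ) (a b : ℝ) :
    ContDiff ℝ k fun z : E => ∫ l in a..b, ψ (z, l) :=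
  (contDiff_parametric_primitive k ψ hψ a).comp
    (contDiff_id.prodMk (contDiff_const : ContDiff ℝ k fun _ : E => b))

/-- Smoothness of `x, t ↦ b(x) exp(-f(x) ∫₀ᵗ Ψ(x, ∫₀ˣ u(ξ,s) dξ) ds)` exceeds that of `u`. -/
lemma contDiff_succ_expForm {k : ℕ} {f b : ℝ → ℝ} {Ψ u : ℝ × ℝ → ℝ}
    (hf : ContDiff ℝ (k + 1 : ℕ) f) (hb : ContDiff ℝ (k + 1 : ℕ) b)
    (hΨ : ContDiff ℝ (k + 1 : ℕ) Ψ) (hu : ContDiff ℝ k u) :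
    ContDiff ℝ (k + 1 : ℕ) fun q : ℝ × ℝ => b q.1 *
      Real.exp (-f q.1 * ∫ s in (0 : ℝ)..q.2, Ψ (q.1, ∫ ξ in (0 : ℝ)..q.1, u (ξ, s))) := by
  have hV := contDiff_spaceIntegral hu
  have hΨ' := hΨ
  rw [Nat.cast_succ, contDiff_succ_iff_fderiv] at hΨ'
  have hle : (k : WithTop ℕ∞) ≤ ((k + 1 : ℕ) : WithTop ℕ∞) := by exact_mod_cast Nat.le_succ k
  have hpair : ContDiff ℝ k fun q : ℝ × ℝ => (q.1, ∫ ξ in (0 : ℝ)..q.1, u (ξ, q.2)) :=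
    contDiff_fst.prodMk hV
  have hP := contDiff_succ_parametric_primitive (k := k)
    (G := fun q : ℝ × ℝ => Ψ (q.1, ∫ ξ in (0 : ℝ)..q.1, u (ξ, q.2)))
    (G' := fun q : ℝ × ℝ => ContinuousLinearMap.toSpanSingleton ℝ
      (fderiv ℝ Ψ (q.1, ∫ ξ in (0 : ℝ)..q.1, u (ξ, q.2)) (1, u q)))
    ((hΨ.of_le hle).comp hpair)
    ((ContinuousLinearMap.toSpanSingletonCLE (𝕜 := ℝ) (E := ℝ)).contDiff.comp
      ((hΨ'.2.2.comp hpair).clm_apply (contDiff_const.prodMk hu)))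
    (fun x s => by
      have hc : Continuous fun ξ => u (ξ, s) := hu.continuous.comp (by fun_prop)
      have h1 : HasDerivAt (fun x => ∫ ξ in (0 : ℝ)..x, u (ξ, s)) (u (x, s)) x :=
        intervalIntegral.integral_hasDerivAt_right (hc.intervalIntegrable _ _)
          hc.stronglyMeasurable.stronglyMeasurableAtFilter hc.continuousAt
      exact ((hΨ'.1 _).hasFDerivAt.comp_hasDerivAt x ((hasDerivAt_id x).prodMk h1)).hasFDerivAt)
    0
  exact (hb.comp contDiff_fst).mul
    (Real.contDiff_exp.comp (((hf.comp contDiff_fst).neg).mul hP))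

lemma exists_contDiff_eqOn_of_expForm {p : ℕ} {f b : ℝ → ℝ} {Ψ : ℝ × ℝ → ℝ} {c : ℝ → ℝ → ℝ}
    {L T : ℝ} (hf : ContDiff ℝ p f) (hb : ContDiff ℝ p b) (hΨ : ContDiff ℝ p Ψ)
    {u₀ : ℝ × ℝ → ℝ} (hu₀ : Continuous u₀)
    (hu₀c : ∀ x ∈ Icc 0 L, ∀ t ∈ Icc 0 T, u₀ (x, t) = c x t)
    (hc : ∀ x ∈ Icc 0 L, ∀ t ∈ Icc 0 T, c x t
      = b x * Real.exp (-f x * ∫ s in (0 : ℝ)..t, Ψ (x, ∫ ξ in (0 : ℝ)..x, c ξ s))) :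
    ∀ k ≤ p, ∃ u : ℝ × ℝ → ℝ, ContDiff ℝ k u ∧
      ∀ x ∈ Icc 0 L, ∀ t ∈ Icc 0 T, u (x, t) = c x t := by
  intro k hk
  induction k with
  | zero => exact ⟨u₀, by rwa [Nat.cast_zero, contDiff_zero], hu₀c⟩
  | succ k ih =>
    obtain ⟨u, hu, huc⟩ := ih (by omega)
    have hle : ((k + 1 : ℕ) : WithTop ℕ∞) ≤ p := by exact_mod_cast hk
    refine ⟨_, contDiff_succ_expForm (hf.of_le hle) (hb.of_le hle) (hΨ.of_le hle) hu,
      fun x hx t ht => ?_⟩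
    rw [hc x hx t ht]
    dsimp only
    congr 3
    refine intervalIntegral.integral_congr fun s hs => ?_
    rw [uIcc_of_le ht.1] at hs
    congr 2
    refine intervalIntegral.integral_congr fun ξ hξ => ?_
    rw [uIcc_of_le hx.1] at hξ
    exact huc ξ ⟨hξ.1, hξ.2.trans hx.2⟩ s ⟨hs.1, hs.2.trans ht.2⟩

/-- Solution of a scalar linear equation `y' = -y a φ`. -/
lemma eq_mul_exp_of_hasDerivWithinAt {T a : ℝ} {y φ : ℝ → ℝ} (hφ : Continuous φ)
    (hy : ∀ t ∈ Icc 0 T, HasDerivWithinAt y (-y t * a * φ t) (Icc 0 T) t) {t : ℝ}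
    (ht : t ∈ Icc 0 T) : y t = y 0 * Real.exp (-a * ∫ s in (0 : ℝ)..t, φ s) := by
  have hT : 0 ≤ T := ht.1.trans ht.2
  rcases hT.eq_or_lt with rfl | hT'
  · obtain rfl : t = 0 := le_antisymm ht.2 ht.1
    simp
  have hA : ∀ t, HasDerivAt (fun t => ∫ s in (0 : ℝ)..t, φ s) (φ t) t := fun t =>
    intervalIntegral.integral_hasDerivAt_right (hφ.intervalIntegrable _ _)
      hφ.stronglyMeasurable.stronglyMeasurableAtFilter hφ.continuousAt
  have hz : ∀ t ∈ Icc 0 T, HasDerivWithinAt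
      (fun t => y t * Real.exp (a * ∫ s in (0 : ℝ)..t, φ s)) 0 (Icc 0 T) t := by
    intro t ht
    have := (hy t ht).mul (((hA t).const_mul a).exp.hasDerivWithinAt (s := Icc 0 T))
    exact this.congr_deriv (by ring)
  have hconst := (convex_Icc 0 T).is_const_of_fderivWithin_eq_zero (𝕜 := ℝ)
    (fun x hx => (hz x hx).differentiableWithinAt)
    (fun x hx => by
      have h := (hz x hx).hasFDerivWithinAt.fderivWithin (uniqueDiffOn_Icc hT' x hx)
      rw [h]; ext; simp) ht ⟨le_rfl, hT⟩
  simp only [intervalIntegral.integral_same, mul_zero, Real.exp_zero, mul_one] at hconst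
  rw [← hconst, mul_assoc, ← Real.exp_add]
  simp

namespace PhotoModel

/-- The composition of `rho` with the light intensity is the restriction of a `C^p` function. -/
lemma exists_contDiff_rho_iota {M : PhotoModel} {p : ℕ} (hM : M.Admissible) (hs : M.Smooth p) :
    ∃ ψ : (ℝ × ℝ) × ℝ → ℝ, ContDiff ℝ p ψ ∧
      ∀ x ∈ Icc 0 M.L, ∀ S : ℝ, ∀ l ∈ Icc M.lam0 M.lamS,
        ψ ((x, S), l) = M.rho (M.iota l (M.C0 x) S) := by
  obtain ⟨b, hb, hbe⟩ := hs.c0_smooth.exists_contDiff_eqOn_Icc hM.L_pos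
  obtain ⟨I, hI, hIe⟩ := hs.I_smooth.exists_contDiff_eqOn_Icc hM.lam_lt
  obtain ⟨eA, heA, heAe⟩ := hs.epsA_smooth.exists_contDiff_eqOn_Icc hM.lam_lt
  obtain ⟨eB, heB, heBe⟩ := hs.epsB_smooth.exists_contDiff_eqOn_Icc hM.lam_lt
  obtain ⟨ρ, hρ, hρe⟩ := hs.rho_smooth.exists_contDiff_eqOn_Ici
  have hB : ContDiff ℝ p fun x : ℝ => ∫ ξ in (0 : ℝ)..x, b ξ :=
    (contDiff_parametric_primitive p (fun q : ℝ × ℝ => b q.2) (hb.comp contDiff_snd) 0).comp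
      ((contDiff_const (c := (0 : ℝ))).prodMk contDiff_id)
  have hx : ContDiff ℝ p fun q : (ℝ × ℝ) × ℝ => q.1.1 := contDiff_fst.comp contDiff_fst
  have hS : ContDiff ℝ p fun q : (ℝ × ℝ) × ℝ => q.1.2 := contDiff_snd.comp contDiff_fst
  have hl : ContDiff ℝ p fun q : (ℝ × ℝ) × ℝ => q.2 := contDiff_snd
  refine ⟨fun q => ρ (I q.2 * Real.exp (-M.mu * (eB q.2 * (∫ ξ in (0 : ℝ)..q.1.1, b ξ)
    + (eA q.2 - eB q.2) * q.1.2))), ?_, fun x hx S l hl => ?_⟩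
  · exact hρ.comp ((hI.comp hl).mul (Real.contDiff_exp.comp (contDiff_const.mul
      (((heB.comp hl).mul (hB.comp hx)).add (((heA.comp hl).sub (heB.comp hl)).mul hS)))))
  · have hC : (∫ ξ in (0 : ℝ)..x, b ξ) = M.C0 x := by
      refine intervalIntegral.integral_congr fun ξ hξ => ?_
      rw [uIcc_of_le hx.1] at hξ
      exact hbe ⟨hξ.1, hξ.2.trans hx.2⟩
    have hι : I l * Real.exp (-M.mu * (eB l * (∫ ξ in (0 : ℝ)..x, b ξ) + (eA l - eB l) * S))
        = M.iota l (M.C0 x) S := by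
      rw [hC, hIe hl, heAe hl, heBe hl]; rfl
    dsimp only
    rw [hι]
    exact hρe (mul_nonneg (hM.I_mem l hl).1 (Real.exp_pos _).le)

lemma integral_rho_iota {M : PhotoModel} (hM : M.Admissible) {ψ : (ℝ × ℝ) × ℝ → ℝ}
    (hψ : ∀ x ∈ Icc 0 M.L, ∀ S : ℝ, ∀ l ∈ Icc M.lam0 M.lamS,
      ψ ((x, S), l) = M.rho (M.iota l (M.C0 x) S)) {x : ℝ} (hx : x ∈ Icc 0 M.L) (S : ℝ) :
    ∫ l in M.lam0..M.lamS, M.rho (M.iota l (M.C0 x) S)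
      = ∫ l in M.lam0..M.lamS, ψ ((x, S), l) := by
  refine intervalIntegral.integral_congr fun l hl => ?_
  rw [uIcc_of_le hM.lam_lt.le] at hl
  exact (hψ x hx S l hl).symm

/-- A classical solution is the restriction of a `C^p` function, and satisfies the integrated
(logarithmic) form of the equation. -/
theorem IsSolution.exists_regular {M : PhotoModel} {p : ℕ} (hM : M.Admissible) (hs : M.Smooth p)
    {c : ℝ → ℝ → ℝ} (hc : M.IsSolution c) {ψ : (ℝ × ℝ) × ℝ → ℝ} (hψ : ContDiff ℝ p ψ)
    (hψe : ∀ x ∈ Icc 0 M.L, ∀ S : ℝ, ∀ l ∈ Icc M.lam0 M.lamS,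
      ψ ((x, S), l) = M.rho (M.iota l (M.C0 x) S)) :
    ∃ u : ℝ × ℝ → ℝ, ContDiff ℝ p u ∧
      (∀ x ∈ Icc 0 M.L, ∀ t ∈ Icc 0 M.T, u (x, t) = c x t) ∧
      ∀ x ∈ Icc 0 M.L, ∀ t ∈ Icc 0 M.T, c x t = M.c0 x * Real.exp (-M.f x *
        ∫ s in (0 : ℝ)..t, ∫ l in M.lam0..M.lamS, ψ ((x, ∫ ξ in (0 : ℝ)..x, u (ξ, s)), l)) := by
  obtain ⟨b, hb, hbe⟩ := hs.c0_smooth.exists_contDiff_eqOn_Icc hM.L_pos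
  obtain ⟨f, hf, hfe⟩ := hs.f_smooth.exists_contDiff_eqOn_Icc hM.L_pos
  set u₀ : ℝ × ℝ → ℝ := fun q =>
    c (projIcc 0 M.L hM.L_pos.le q.1) (projIcc 0 M.T hM.T_pos.le q.2) with hu₀def
  have hu₀ : Continuous u₀ := hc.continuousOn.comp_continuous
    (f := fun q : ℝ × ℝ => (((projIcc 0 M.L hM.L_pos.le q.1 : ℝ)),
      ((projIcc 0 M.T hM.T_pos.le q.2 : ℝ)))) (by fun_prop)
    (fun q => ⟨(projIcc 0 M.L hM.L_pos.le q.1).2, (projIcc 0 M.T hM.T_pos.le q.2).2⟩)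
  have hu₀c : ∀ x ∈ Icc 0 M.L, ∀ t ∈ Icc 0 M.T, u₀ (x, t) = c x t := by
    intro x hx t ht
    simp only [hu₀def, projIcc_of_mem _ hx, projIcc_of_mem _ ht]
  set Ψ : ℝ × ℝ → ℝ := fun z => ∫ l in M.lam0..M.lamS, ψ (z, l) with hΨdef
  have hΨ : ContDiff ℝ p Ψ := contDiff_intervalIntegral_right hψ _ _
  have hint : ∀ u : ℝ × ℝ → ℝ, (∀ x ∈ Icc 0 M.L, ∀ t ∈ Icc 0 M.T, u (x, t) = c x t) →
      ∀ x ∈ Icc 0 M.L, ∀ s ∈ Icc 0 M.T,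
      (∫ ξ in (0 : ℝ)..x, u (ξ, s)) = ∫ ξ in (0 : ℝ)..x, c ξ s := by
    intro u hu x hx s hs
    refine intervalIntegral.integral_congr fun ξ hξ => ?_
    rw [uIcc_of_le hx.1] at hξ
    exact hu ξ ⟨hξ.1, hξ.2.trans hx.2⟩ s hs
  have hform : ∀ u : ℝ × ℝ → ℝ, Continuous u →
      (∀ x ∈ Icc 0 M.L, ∀ t ∈ Icc 0 M.T, u (x, t) = c x t) →
      ∀ x ∈ Icc 0 M.L, ∀ t ∈ Icc 0 M.T, c x t
        = M.c0 x * Real.exp (-M.f x * ∫ s in (0 : ℝ)..t, Ψ (x, ∫ ξ in (0 : ℝ)..x, u (ξ, s))) := by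
    intro u hu huc x hx t ht
    have hφ : Continuous fun s => Ψ (x, ∫ ξ in (0 : ℝ)..x, u (ξ, s)) := by
      have h0 : ContDiff ℝ (0 : ℕ) u := by rwa [Nat.cast_zero, contDiff_zero]
      have h1 := (contDiff_spaceIntegral h0).continuous
      exact hΨ.continuous.comp (continuous_const.prodMk
        (h1.comp (by fun_prop : Continuous fun s : ℝ => (x, s))))
    rw [← hc.init x hx]
    refine eq_mul_exp_of_hasDerivWithinAt (y := fun t => c x t) hφ (fun s hs => ?_) ht
    have h2 := hc.hasDeriv x hx s hs
    rwa [integral_rho_iota hM hψe hx, ← hint u huc x hx s hs] at h2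
  have hc' : ∀ x ∈ Icc 0 M.L, ∀ t ∈ Icc 0 M.T, c x t
      = b x * Real.exp (-f x * ∫ s in (0 : ℝ)..t, Ψ (x, ∫ ξ in (0 : ℝ)..x, c ξ s)) := by
    intro x hx t ht
    rw [hform u₀ hu₀ hu₀c x hx t ht, hbe hx, hfe hx]
    congr 3
    refine intervalIntegral.integral_congr fun s hs => ?_
    rw [uIcc_of_le ht.1] at hs
    rw [hint u₀ hu₀c x hx s ⟨hs.1, hs.2.trans ht.2⟩]
  obtain ⟨u, hu, huc⟩ := exists_contDiff_eqOn_of_expForm hf hb hΨ hu₀ hu₀c hc' p le_rfl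
  exact ⟨u, hu, huc, hform u hu.continuous huc⟩

end PhotoModel

lemma abs_exp_sub_exp_le {a b D : ℝ} (ha : a ≤ D) (hb : b ≤ D) :
    |Real.exp a - Real.exp b| ≤ Real.exp D * |a - b| := by
  have key : ∀ a b : ℝ, a ≤ b → b ≤ D → |Real.exp a - Real.exp b| ≤ Real.exp D * |a - b| := by
    intro a b hab hb
    rw [abs_sub_comm, abs_of_nonneg (sub_nonneg.2 (Real.exp_le_exp.2 hab)), abs_sub_comm,
      abs_of_nonneg (sub_nonneg.2 hab)]
    have h1 : Real.exp a = Real.exp b * Real.exp (a - b) := by rw [← Real.exp_add]; ring_nf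
    have h2 := Real.add_one_le_exp (a - b)
    have h3 := Real.exp_le_exp.2 hb
    have h4 := Real.exp_pos b
    nlinarith
  rcases le_total a b with h | h
  · exact key a b h hb
  · rw [abs_sub_comm, abs_sub_comm a]
    exact key b a h ha

lemma implicit_sum_gronwall {N : ℕ} {s : ℕ → ℝ} {a δ : ℝ} (ha : 0 ≤ a) (ha' : a ≤ 1 / 2)
    (hs0 : ∀ n, 0 ≤ s n)
    (hs : ∀ n ≤ N, s n ≤ δ + a * ∑ p ∈ Finset.range (n + 1), s p) :
    ∀ n ≤ N, s n ≤ 2 * δ * (1 + 2 * a) ^ n := by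
  have h1 : ∀ n ≤ N, s n ≤ 2 * δ + 2 * a * ∑ p ∈ Finset.range n, s p := by
    intro n hn
    have h := hs n hn
    rw [Finset.sum_range_succ] at h
    nlinarith [hs0 n]
  have h2 : ∀ n ≤ N, 2 * δ + 2 * a * ∑ p ∈ Finset.range n, s p ≤ 2 * δ * (1 + 2 * a) ^ n := by
    intro n hn
    induction n with
    | zero => simp
    | succ n ih =>
      have i1 := ih (by omega)
      have i2 := h1 n (by omega)
      rw [Finset.sum_range_succ, pow_succ]
      nlinarith
  exact fun n hn => (h1 n hn).trans (h2 n hn)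

/-- A discrete Gronwall inequality for grid functions of two variables. -/
lemma discrete_gronwall_grid {Nx Nt : ℕ} {e : ℕ → ℕ → ℝ} {L T hx ht A δ : ℝ} (he : ∀ j n, 0 ≤ e j n)
    (hNx : 1 ≤ Nx) (hNt : 1 ≤ Nt) (hhx : 0 ≤ hx) (hht : 0 ≤ ht) (hL : (Nx : ℝ) * hx = L)
    (hT : (Nt : ℝ) * ht = T) (hA : 0 ≤ A) (hδ : 0 ≤ δ) (hsmall : 2 * L * A * ht ≤ 1 / 2)
    (h : ∀ j ≤ Nx, ∀ n ≤ Nt, e j n ≤ δ + A * (ht * ∑ p ∈ Finset.range (n + 1),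
      hx * ∑ k ∈ Finset.range (Nx + 1), e k p)) :
    ∀ j ≤ Nx, ∀ n ≤ Nt, e j n ≤ (1 + A * (2 * T * (4 * L * Real.exp (4 * L * A * T)))) * δ := by
  have hL0 : 0 ≤ L := hL ▸ by positivity
  have hT0 : 0 ≤ T := hT ▸ by positivity
  have hNx' : (1 : ℝ) ≤ Nx := by exact_mod_cast hNx
  have hNt' : (1 : ℝ) ≤ Nt := by exact_mod_cast hNt
  set s : ℕ → ℝ := fun p => hx * ∑ k ∈ Finset.range (Nx + 1), e k p with hsdef
  have hs0 : ∀ p, 0 ≤ s p := fun p => mul_nonneg hhx (Finset.sum_nonneg fun k _ => he k p)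
  have hs : ∀ n ≤ Nt, s n ≤ 2 * L * δ + 2 * L * A * ht * ∑ p ∈ Finset.range (n + 1), s p := by
    intro n hn
    set Y := δ + A * (ht * ∑ p ∈ Finset.range (n + 1), s p) with hY
    have hY0 : 0 ≤ Y := by
      have := Finset.sum_nonneg (s := Finset.range (n + 1)) fun p _ => hs0 p
      positivity
    have h1 : ∑ k ∈ Finset.range (Nx + 1), e k n ≤ ((Nx : ℝ) + 1) * Y := by
      refine (Finset.sum_le_card_nsmul _ _ Y fun k hk => h k ?_ n hn).trans (by simp)
      rw [Finset.mem_range] at hk; omega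
    have h2 : hx * ((Nx : ℝ) + 1) ≤ 2 * L := by nlinarith
    calc s n ≤ hx * (((Nx : ℝ) + 1) * Y) := mul_le_mul_of_nonneg_left h1 hhx
      _ = (hx * ((Nx : ℝ) + 1)) * Y := by ring
      _ ≤ 2 * L * Y := mul_le_mul_of_nonneg_right h2 hY0
      _ = _ := by rw [hY]; ring
  have ha : 0 ≤ 2 * L * A * ht := by positivity
  have hg : ∀ n ≤ Nt, s n ≤ 4 * L * Real.exp (4 * L * A * T) * δ := by
    intro n hn
    have h1 := implicit_sum_gronwall ha hsmall hs0 hs n hn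
    have h2 : (1 + 2 * (2 * L * A * ht)) ^ n ≤ Real.exp (4 * L * A * T) := by
      have hnT : (n : ℝ) * ht ≤ T := by
        rw [← hT]; exact mul_le_mul_of_nonneg_right (by exact_mod_cast hn) hht
      calc (1 + 2 * (2 * L * A * ht)) ^ n ≤ Real.exp (2 * (2 * L * A * ht)) ^ n :=
            pow_le_pow_left₀ (by positivity) (by
              have := Real.add_one_le_exp (2 * (2 * L * A * ht)); linarith) n
        _ = Real.exp (4 * L * A * (n * ht)) := by rw [← Real.exp_nat_mul]; ring_nf
        _ ≤ _ := Real.exp_le_exp.2 (mul_le_mul_of_nonneg_left hnT (by positivity))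
    calc s n ≤ 2 * (2 * L * δ) * (1 + 2 * (2 * L * A * ht)) ^ n := h1
      _ ≤ 2 * (2 * L * δ) * Real.exp (4 * L * A * T) :=
        mul_le_mul_of_nonneg_left h2 (by positivity)
      _ = _ := by ring
  intro j hj n hn
  refine (h j hj n hn).trans ?_
  set Z := 4 * L * Real.exp (4 * L * A * T) * δ with hZ
  have hZ0 : 0 ≤ Z := by positivity
  have h1 : ∑ p ∈ Finset.range (n + 1), s p ≤ ((Nt : ℝ) + 1) * Z := by
    refine (Finset.sum_le_card_nsmul _ _ Z fun p hp => hg p ?_).trans ?_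
    · rw [Finset.mem_range] at hp; omega
    · have : (n : ℝ) ≤ Nt := by exact_mod_cast hn
      rw [Finset.card_range, nsmul_eq_mul]
      push_cast
      exact mul_le_mul_of_nonneg_right (by linarith) hZ0
  have h2 : ht * ((Nt : ℝ) + 1) ≤ 2 * T := by nlinarith
  have h3 : ht * ∑ p ∈ Finset.range (n + 1), s p ≤ 2 * T * Z := by
    calc ht * ∑ p ∈ Finset.range (n + 1), s p ≤ ht * (((Nt : ℝ) + 1) * Z) :=
          mul_le_mul_of_nonneg_left h1 hht
      _ = (ht * ((Nt : ℝ) + 1)) * Z := by ring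
      _ ≤ _ := mul_le_mul_of_nonneg_right h2 hZ0
  calc δ + A * (ht * ∑ p ∈ Finset.range (n + 1), s p) ≤ δ + A * (2 * T * Z) := by
        have := mul_le_mul_of_nonneg_left h3 hA; linarith
    _ = _ := by rw [hZ]; ring

namespace PhotoModel

variable {M : PhotoModel}

lemma dx_pos (hM : M.Admissible) {N : ℕ} (hN : 0 < N) : 0 < M.dx N :=
  div_pos hM.L_pos (by exact_mod_cast hN)

lemma dt_pos (hM : M.Admissible) {N : ℕ} (hN : 0 < N) : 0 < M.dt N :=
  div_pos hM.T_pos (by exact_mod_cast hN)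

lemma dlam_pos (hM : M.Admissible) {N : ℕ} (hN : 0 < N) : 0 < M.dlam N :=
  div_pos (sub_pos.2 hM.lam_lt) (by exact_mod_cast hN)

lemma mul_dx (M : PhotoModel) {N : ℕ} (hN : 0 < N) : (N : ℝ) * M.dx N = M.L :=
  mul_div_cancel₀ _ (by exact_mod_cast hN.ne')

lemma mul_dt (M : PhotoModel) {N : ℕ} (hN : 0 < N) : (N : ℝ) * M.dt N = M.T :=
  mul_div_cancel₀ _ (by exact_mod_cast hN.ne')

lemma mul_dlam (M : PhotoModel) {N : ℕ} (hN : 0 < N) : (N : ℝ) * M.dlam N = M.lamS - M.lam0 :=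
  mul_div_cancel₀ _ (by exact_mod_cast hN.ne')

lemma node_mem_Icc {h X : ℝ} {j N : ℕ} (hh : 0 ≤ h) (hX : (N : ℝ) * h = X) (hj : j ≤ N) :
    (j : ℝ) * h ∈ Icc 0 X :=
  ⟨by positivity, hX ▸ mul_le_mul_of_nonneg_right (by exact_mod_cast hj) hh⟩

lemma dlam_node_mem (hM : M.Admissible) {N l : ℕ} (hN : 0 < N) (hl : l ≤ N) :
    M.lam0 + (l : ℝ) * M.dlam N ∈ Icc M.lam0 M.lamS := by
  have h := node_mem_Icc (dlam_pos hM hN).le (M.mul_dlam hN) hl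
  exact ⟨by linarith [h.1], by linarith [h.2]⟩

lemma exists_abs_dqLight_le (hM : M.Admissible) {n₀ : ℕ} (hn₀ : 1 ≤ n₀) :
    ∃ B : ℝ, 0 ≤ B ∧ ∀ Nx Nl : ℕ, n₀ ≤ Nl → ∀ (C : ℕ → ℕ → ℝ) (j p : ℕ),
      |M.dqLight n₀ Nx Nl C j p| ≤ B := by
  obtain ⟨R, hR⟩ := hM.rho_bdd
  have hR0 : 0 ≤ R := (hM.rho_nonneg 0 le_rfl).trans (hR 0 le_rfl)
  have hΛ : 0 ≤ M.lamS - M.lam0 := (sub_pos.2 hM.lam_lt).le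
  refine ⟨gregoryWeightBound n₀ * (2 * (M.lamS - M.lam0) * R),
    mul_nonneg (gregoryWeightBound_nonneg n₀) (by positivity), fun Nx Nl hNl C j p => ?_⟩
  have hNl0 : 0 < Nl := by omega
  refine abs_gregorySum_le_of_bound hn₀ hNl (dlam_pos hM hNl0).le (M.mul_dlam hNl0).le hR0
    fun l hl => ?_
  have hι : ∀ C S, 0 ≤ M.iota (M.lam0 + (l : ℝ) * M.dlam Nl) C S := fun C S =>
    mul_nonneg (hM.I_mem _ (dlam_node_mem hM hNl0 hl)).1 (Real.exp_pos _).le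
  rw [abs_of_nonneg (hM.rho_nonneg _ (hι _ _))]
  exact hR _ (hι _ _)

lemma IsDQ.eq_exp (hM : M.Admissible) {n₀ Nx Nt Nl : ℕ} (hNx : 0 < Nx) {C : ℕ → ℕ → ℝ}
    (hC : M.IsDQ n₀ Nx Nt Nl C) {j n : ℕ} (hj : n₀ ≤ j) (hj' : j ≤ Nx) (hn : n₀ ≤ n)
    (hn' : n ≤ Nt) :
    C j n = M.c0 ((j : ℝ) * M.dx Nx) * Real.exp (-M.f ((j : ℝ) * M.dx Nx) *
      gregorySum n₀ (M.dt Nt) n (fun p => M.dqLight n₀ Nx Nl C j p)) := by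
  have h0 : 0 < M.c0 ((j : ℝ) * M.dx Nx) :=
    hM.c0_pos _ (node_mem_Icc (dx_pos hM hNx).le (M.mul_dx hNx) hj')
  have hpos := hC.pos j n hj hj' hn hn'
  rw [← hC.scheme j n hj hj' hn hn', hC.init j hj', Real.exp_log (div_pos hpos h0)]
  field_simp

/-- An upper bound for the exponents in the exponential form of the scheme. -/
lemma exists_exponent_le (hM : M.Admissible) {p n₀ : ℕ} (hs : M.Smooth p) (hn₀ : 1 ≤ n₀) :
    ∃ D : ℝ, 0 ≤ D ∧ ∀ Nx Nt Nl : ℕ, 0 < Nx → 0 < Nt → n₀ ≤ Nl → ∀ (C : ℕ → ℕ → ℝ) (j n : ℕ),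
      j ≤ Nx → n₀ ≤ n → n ≤ Nt → -M.f ((j : ℝ) * M.dx Nx) *
        gregorySum n₀ (M.dt Nt) n (fun p => M.dqLight n₀ Nx Nl C j p) ≤ D := by
  obtain ⟨B, hB, hlight⟩ := exists_abs_dqLight_le hM hn₀
  obtain ⟨F, hF⟩ := isCompact_Icc.exists_bound_of_continuousOn hs.f_smooth.continuousOn
  have hF0 : 0 ≤ F := (norm_nonneg _).trans (hF 0 ⟨le_rfl, hM.L_pos.le⟩)
  have hT := hM.T_pos.le
  have hW := gregoryWeightBound_nonneg n₀
  refine ⟨F * (gregoryWeightBound n₀ * (2 * M.T * B)), by positivity,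
    fun Nx Nt Nl hNx hNt hNl C j n hj hn hn' => ?_⟩
  refine (le_abs_self _).trans ?_
  rw [abs_mul, abs_neg]
  refine mul_le_mul (hF _ (node_mem_Icc (dx_pos hM hNx).le (M.mul_dx hNx) hj)) ?_ (abs_nonneg _) hF0
  exact abs_gregorySum_le_of_bound hn₀ hn (dt_pos hM hNt).le
    (node_mem_Icc (dt_pos hM hNt).le (M.mul_dt hNt) hn').2 hB fun q _ => hlight _ _ hNl _ _ _

lemma step_le (hM : M.Admissible) {Nx Nt Nl : ℕ} (hNx : 0 < Nx) (hNt : 0 < Nt) (hNl : 0 < Nl) :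
    M.dx Nx + M.dt Nt + M.dlam Nl ≤ M.L + M.T + (M.lamS - M.lam0) := by
  have h1 := node_mem_Icc (dx_pos hM hNx).le (M.mul_dx hNx) (show 1 ≤ Nx from hNx)
  have h2 := node_mem_Icc (dt_pos hM hNt).le (M.mul_dt hNt) (show 1 ≤ Nt from hNt)
  have h3 := node_mem_Icc (dlam_pos hM hNl).le (M.mul_dlam hNl) (show 1 ≤ Nl from hNl)
  simp only [Nat.cast_one, one_mul] at h1 h2 h3
  linarith [h1.2, h2.2, h3.2]

lemma IsSolution.exists_bound {c : ℝ → ℝ → ℝ} (hc : M.IsSolution c) :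
    ∃ B : ℝ, ∀ x ∈ Icc 0 M.L, ∀ t ∈ Icc 0 M.T, |c x t| ≤ B := by
  obtain ⟨B, hB⟩ := (isCompact_Icc.prod isCompact_Icc).exists_bound_of_continuousOn hc.continuousOn
  exact ⟨B, fun x hx t ht => hB (x, t) ⟨hx, ht⟩⟩

/-- A priori bound for DQ approximations with controlled starting values. -/
lemma exists_abs_le_of_isDQ (hM : M.Admissible) {p n₀ : ℕ} (hs : M.Smooth p) (hn₀ : 1 ≤ n₀)
    {c : ℝ → ℝ → ℝ} (hc : M.IsSolution c) (K : ℝ) :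
    ∃ B : ℝ, 0 ≤ B ∧ ∀ Nx Nt Nl : ℕ, 0 < Nx → 0 < Nt → n₀ ≤ Nl →
      ∀ C : ℕ → ℕ → ℝ, M.IsDQ n₀ Nx Nt Nl C →
        (∀ j n : ℕ, j ≤ Nx → n ≤ Nt → (j < n₀ ∨ n < n₀) →
          |c ((j : ℝ) * M.dx Nx) ((n : ℝ) * M.dt Nt) - C j n|
            ≤ K * (M.dx Nx + M.dt Nt + M.dlam Nl) ^ (n₀ + 1)) →
        ∀ j n : ℕ, j ≤ Nx → n ≤ Nt → |C j n| ≤ B := by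
  obtain ⟨D, hD, hexp⟩ := exists_exponent_le hM hs hn₀
  obtain ⟨B, hB⟩ := hc.exists_bound
  obtain ⟨B0, hB0⟩ := isCompact_Icc.exists_bound_of_continuousOn hs.c0_smooth.continuousOn
  have hB00 : 0 ≤ B0 := (norm_nonneg _).trans (hB0 0 ⟨le_rfl, hM.L_pos.le⟩)
  set X := |K| * (M.L + M.T + (M.lamS - M.lam0)) ^ (n₀ + 1)
  refine ⟨max (B0 * Real.exp D) (B + X), le_max_of_le_left (by positivity),
    fun Nx Nt Nl hNx hNt hNl C hC hstart j n hj hn => ?_⟩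
  have hNl0 : 0 < Nl := by omega
  have hxj := node_mem_Icc (dx_pos hM hNx).le (M.mul_dx hNx) hj
  have htn := node_mem_Icc (dt_pos hM hNt).le (M.mul_dt hNt) hn
  by_cases hst : j < n₀ ∨ n < n₀
  · refine le_max_of_le_right ?_
    have h1 := hstart j n hj hn hst
    have h2 := hB _ hxj _ htn
    have hH : 0 ≤ M.dx Nx + M.dt Nt + M.dlam Nl := by
      linarith [dx_pos hM hNx, dt_pos hM hNt, dlam_pos hM hNl0]
    have h3 : K * (M.dx Nx + M.dt Nt + M.dlam Nl) ^ (n₀ + 1) ≤ X :=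
      mul_le_mul (le_abs_self K) (pow_le_pow_left₀ hH (step_le hM hNx hNt hNl0) _)
        (pow_nonneg hH _) (abs_nonneg K)
    have h4 : C j n = c ((j : ℝ) * M.dx Nx) ((n : ℝ) * M.dt Nt)
        - (c ((j : ℝ) * M.dx Nx) ((n : ℝ) * M.dt Nt) - C j n) := by ring
    rw [h4]
    exact (abs_sub _ _).trans (add_le_add h2 (h1.trans h3))
  · push Not at hst
    refine le_max_of_le_left ?_
    rw [hC.eq_exp hM hNx hst.1 hj hst.2 hn, abs_mul, abs_of_pos (Real.exp_pos _)]
    exact mul_le_mul (hB0 _ hxj) (Real.exp_le_exp.2 (hexp _ _ _ hNx hNt hNl _ _ _ hj hst.2 hn))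
      (Real.exp_pos _).le hB00

end PhotoModel

namespace PhotoModel

variable {M : PhotoModel}

/-- Error of the discretized light integral in terms of the error of the space integral. -/
lemma exists_dqLight_error (hM : M.Admissible) {n₀ : ℕ} (hn₀ : 1 ≤ n₀)
    {ψ : (ℝ × ℝ) × ℝ → ℝ} (hψ : ContDiff ℝ (n₀ + 1 : ℕ) ψ)
    (hψe : ∀ x ∈ Icc 0 M.L, ∀ S : ℝ, ∀ l ∈ Icc M.lam0 M.lamS,
      ψ ((x, S), l) = M.rho (M.iota l (M.C0 x) S)) (B : ℝ) :
    ∃ A : ℝ, 0 ≤ A ∧ ∀ Nx Nl : ℕ, 0 < Nx → n₀ ≤ Nl → ∀ (C : ℕ → ℕ → ℝ) (j p : ℕ) (S : ℝ),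
      j ≤ Nx → |S| ≤ B → |M.dqSpace n₀ Nx C j p| ≤ B →
      |(∫ l in M.lam0..M.lamS, ψ (((j : ℝ) * M.dx Nx, S), l)) - M.dqLight n₀ Nx Nl C j p|
        ≤ A * (M.dlam Nl ^ (n₀ + 1) + |S - M.dqSpace n₀ Nx C j p|) := by
  have hΛ : 0 ≤ M.lamS - M.lam0 := (sub_pos.2 hM.lam_lt).le
  have hW := gregoryWeightBound_nonneg n₀
  obtain ⟨A, hA, hquad⟩ := exists_gregorySum_error_bound hn₀
    (G := fun q : (ℝ × ℝ) × ℝ => ψ (q.1, M.lam0 + q.2))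
    (hψ.comp (contDiff_fst.prodMk (contDiff_const.add contDiff_snd)))
    ((isCompact_Icc (a := (0 : ℝ)) (b := M.L)).prod (isCompact_Icc (a := -B) (b := B))) hΛ
  obtain ⟨Λ, hLip⟩ := ((hψ.of_le (m := 1)
    (by exact_mod_cast Nat.succ_le_succ (Nat.zero_le n₀))).locallyLipschitz.locallyLipschitzOn
    ).exists_lipschitzOnWith_of_compact
    (((isCompact_Icc (a := (0 : ℝ)) (b := M.L)).prod (isCompact_Icc (a := -B) (b := B))).prod
      (isCompact_Icc (a := M.lam0) (b := M.lamS)))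
  refine ⟨A + gregoryWeightBound n₀ * (2 * (M.lamS - M.lam0) * Λ), by positivity,
    fun Nx Nl hNx hNl C j p S hj hS hS' => ?_⟩
  have hNl0 : 0 < Nl := by omega
  have hd := (dlam_pos hM hNl0).le
  have hx := node_mem_Icc (dx_pos hM hNx).le (M.mul_dx hNx) hj
  set x := (j : ℝ) * M.dx Nx
  set S' := M.dqSpace n₀ Nx C j p with hS'def
  have h1 := hquad (x, S) ⟨hx, abs_le.1 hS⟩ Nl hNl _ hd (M.mul_dlam hNl0).le
  rw [M.mul_dlam hNl0] at h1
  have hint : (∫ s in (0 : ℝ)..(M.lamS - M.lam0), ψ ((x, S), M.lam0 + s))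
      = ∫ l in M.lam0..M.lamS, ψ ((x, S), l) := by
    rw [intervalIntegral.integral_comp_add_left (fun l => ψ ((x, S), l))]
    simp
  rw [hint] at h1
  have h2 : |gregorySum n₀ (M.dlam Nl) Nl (fun l => ψ ((x, S), M.lam0 + (l : ℝ) * M.dlam Nl))
      - M.dqLight n₀ Nx Nl C j p|
      ≤ gregoryWeightBound n₀ * (2 * (M.lamS - M.lam0) * (Λ * |S - S'|)) := by
    rw [dqLight, gregorySum_sub]
    refine abs_gregorySum_le_of_bound hn₀ hNl hd (M.mul_dlam hNl0).le (by positivity)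
      fun l hl => ?_
    have hl' := dlam_node_mem hM hNl0 hl
    rw [← hψe x hx _ _ hl']
    have h3 := hLip.dist_le_mul ((x, S), M.lam0 + (l : ℝ) * M.dlam Nl) ⟨⟨hx, abs_le.1 hS⟩, hl'⟩
      ((x, S'), M.lam0 + (l : ℝ) * M.dlam Nl) ⟨⟨hx, abs_le.1 hS'⟩, hl'⟩
    simpa [Prod.dist_eq, Real.dist_eq] using h3
  refine (abs_sub_le _ _ _).trans ((add_le_add h1 h2).trans ?_)
  have hp : 0 ≤ M.dlam Nl ^ (n₀ + 1) := pow_nonneg hd _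
  have e1 : 0 ≤ A * |S - S'| := by positivity
  have e2 : 0 ≤ gregoryWeightBound n₀ * (2 * (M.lamS - M.lam0) * Λ) * M.dlam Nl ^ (n₀ + 1) := by
    positivity
  linarith

/-- Error of the discretized space integral. -/
lemma exists_dqSpace_error (hM : M.Admissible) {n₀ : ℕ} (hn₀ : 1 ≤ n₀) {c : ℝ → ℝ → ℝ}
    {u : ℝ × ℝ → ℝ} (hu : ContDiff ℝ (n₀ + 1 : ℕ) u)
    (huc : ∀ x ∈ Icc 0 M.L, ∀ t ∈ Icc 0 M.T, u (x, t) = c x t) :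
    ∃ A : ℝ, 0 ≤ A ∧ ∀ Nx Nt : ℕ, 0 < Nx → 0 < Nt → ∀ (C : ℕ → ℕ → ℝ) (j p : ℕ),
      n₀ ≤ j → j ≤ Nx → p ≤ Nt →
      |(∫ ξ in (0 : ℝ)..((j : ℝ) * M.dx Nx), u (ξ, (p : ℝ) * M.dt Nt)) - M.dqSpace n₀ Nx C j p|
        ≤ A * (M.dx Nx ^ (n₀ + 1) + M.dx Nx * ∑ k ∈ Finset.range (Nx + 1),
            |c ((k : ℝ) * M.dx Nx) ((p : ℝ) * M.dt Nt) - C k p|) := by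
  have hW := gregoryWeightBound_nonneg n₀
  obtain ⟨A, hA, hquad⟩ := exists_gregorySum_error_bound hn₀
    (G := fun q : ℝ × ℝ => u (q.2, q.1)) (hu.comp (contDiff_snd.prodMk contDiff_fst))
    (isCompact_Icc (a := (0 : ℝ)) (b := M.T)) hM.L_pos.le
  refine ⟨A + gregoryWeightBound n₀, by positivity, fun Nx Nt hNx hNt C j p hj hj' hp => ?_⟩
  have hd := (dx_pos hM hNx).le
  have ht := node_mem_Icc (dt_pos hM hNt).le (M.mul_dt hNt) hp
  have hx := node_mem_Icc hd (M.mul_dx hNx) hj'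
  have h1 := hquad _ ht j hj _ hd hx.2
  set E := ∑ k ∈ Finset.range (Nx + 1), |c ((k : ℝ) * M.dx Nx) ((p : ℝ) * M.dt Nt) - C k p|
  have hE : 0 ≤ E := Finset.sum_nonneg fun k _ => abs_nonneg _
  have h2 : |gregorySum n₀ (M.dx Nx) j (fun k => u ((k : ℝ) * M.dx Nx, (p : ℝ) * M.dt Nt))
      - M.dqSpace n₀ Nx C j p| ≤ gregoryWeightBound n₀ * (M.dx Nx * E) := by
    rw [dqSpace, gregorySum_sub]
    refine (abs_gregorySum_le hn₀ hj hd _).trans (mul_le_mul_of_nonneg_left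
      (mul_le_mul_of_nonneg_left ?_ hd) hW)
    refine (Finset.sum_le_sum fun k hk => ?_).trans (Finset.sum_le_sum_of_subset_of_nonneg
      (show Finset.range (j + 1) ⊆ Finset.range (Nx + 1) by intro k; simp; omega)
      fun k _ _ => abs_nonneg _)
    rw [Finset.mem_range] at hk
    rw [huc _ (node_mem_Icc hd (M.mul_dx hNx) (by omega)) _ ht]
  refine (abs_sub_le _ _ _).trans ((add_le_add h1 h2).trans ?_)
  have e1 : 0 ≤ A * (M.dx Nx * E) := by positivity
  have e2 : 0 ≤ gregoryWeightBound n₀ * M.dx Nx ^ (n₀ + 1) := by positivity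
  linarith

/-- Consistency and stability of the scheme: the error satisfies a discrete Gronwall inequality. -/
lemma exists_error_recursion (hM : M.Admissible) {n₀ : ℕ} (hn₀ : 1 ≤ n₀)
    (hs : M.Smooth (n₀ + 1)) {c : ℝ → ℝ → ℝ} (hc : M.IsSolution c) {B : ℝ} (hB : 0 ≤ B) :
    ∃ A : ℝ, 0 ≤ A ∧ ∀ Nx Nt Nl : ℕ, 0 < Nx → 0 < Nt → n₀ ≤ Nl →
      ∀ C : ℕ → ℕ → ℝ, M.IsDQ n₀ Nx Nt Nl C → (∀ j n : ℕ, j ≤ Nx → n ≤ Nt → |C j n| ≤ B) →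
      ∀ j n : ℕ, n₀ ≤ j → j ≤ Nx → n₀ ≤ n → n ≤ Nt →
        |c ((j : ℝ) * M.dx Nx) ((n : ℝ) * M.dt Nt) - C j n|
          ≤ A * (M.dx Nx + M.dt Nt + M.dlam Nl) ^ (n₀ + 1)
            + A * (M.dt Nt * ∑ p ∈ Finset.range (n + 1), M.dx Nx * ∑ k ∈ Finset.range (Nx + 1),
              |c ((k : ℝ) * M.dx Nx) ((p : ℝ) * M.dt Nt) - C k p|) := by
  have hW := gregoryWeightBound_nonneg n₀
  have hL := hM.L_pos.le
  have hT := hM.T_pos.le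
  obtain ⟨ψ, hψ, hψe⟩ := exists_contDiff_rho_iota hM hs
  obtain ⟨u, hu, huc, hform⟩ := hc.exists_regular hM hs hψ hψe
  set V : ℝ × ℝ → ℝ := fun q => ∫ ξ in (0 : ℝ)..q.1, u (ξ, q.2) with hVdef
  have hV : ContDiff ℝ (n₀ + 1 : ℕ) V := contDiff_spaceIntegral hu
  set G : ℝ × ℝ → ℝ := fun q => ∫ l in M.lam0..M.lamS, ψ ((q.1, V q), l) with hGdef
  have hG : ContDiff ℝ (n₀ + 1 : ℕ) G :=
    (contDiff_intervalIntegral_right hψ M.lam0 M.lamS).comp (contDiff_fst.prodMk hV)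
  obtain ⟨BV, hBV⟩ := ((isCompact_Icc (a := (0 : ℝ)) (b := M.L)).prod
    (isCompact_Icc (a := (0 : ℝ)) (b := M.T))).exists_bound_of_continuousOn hV.continuous.continuousOn
  obtain ⟨A₁, hA₁, hspace⟩ := exists_dqSpace_error hM hn₀ hu huc
  obtain ⟨A₂, hA₂, htime⟩ := exists_gregorySum_error_bound hn₀ hG
    (isCompact_Icc (a := (0 : ℝ)) (b := M.L)) hT
  obtain ⟨A₃, hA₃, hlight⟩ := exists_dqLight_error hM hn₀ hψ hψe
    (max BV (gregoryWeightBound n₀ * (2 * M.L * B)))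
  obtain ⟨D, hD, hexp⟩ := exists_exponent_le hM hs hn₀
  obtain ⟨F, hF⟩ := isCompact_Icc.exists_bound_of_continuousOn hs.f_smooth.continuousOn
  have hF0 : 0 ≤ F := (norm_nonneg _).trans (hF 0 ⟨le_rfl, hL⟩)
  obtain ⟨B0, hB0⟩ := isCompact_Icc.exists_bound_of_continuousOn hs.c0_smooth.continuousOn
  have hB00 : 0 ≤ B0 := (norm_nonneg _).trans (hB0 0 ⟨le_rfl, hL⟩)
  set W := gregoryWeightBound n₀
  set Q := B0 * (Real.exp D * F) with hQdef
  have hQ : 0 ≤ Q := by positivity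
  refine ⟨Q * (A₂ + W * (2 * M.T * (A₃ * (1 + A₁)))) + Q * (W * (A₃ * A₁)), by positivity,
    fun Nx Nt Nl hNx hNt hNl C hC hCB j n hj hj' hn hn' => ?_⟩
  have hdx := (dx_pos hM hNx).le
  have hdt := (dt_pos hM hNt).le
  have hdl := (dlam_pos hM (show 0 < Nl by omega)).le
  have hx := node_mem_Icc hdx (M.mul_dx hNx) hj'
  have ht := node_mem_Icc hdt (M.mul_dt hNt) hn'
  set H := M.dx Nx + M.dt Nt + M.dlam Nl with hHdef
  have hH : 0 ≤ H := by positivity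
  have hHx : M.dx Nx ^ (n₀ + 1) ≤ H ^ (n₀ + 1) := pow_le_pow_left₀ hdx (by linarith) _
  have hHt : M.dt Nt ^ (n₀ + 1) ≤ H ^ (n₀ + 1) := pow_le_pow_left₀ hdt (by linarith) _
  have hHl : M.dlam Nl ^ (n₀ + 1) ≤ H ^ (n₀ + 1) := pow_le_pow_left₀ hdl (by linarith) _
  set h' := H ^ (n₀ + 1) with hh'
  have hh0 : 0 ≤ h' := pow_nonneg hH _
  set s : ℕ → ℝ := fun p => M.dx Nx * ∑ k ∈ Finset.range (Nx + 1),
    |c ((k : ℝ) * M.dx Nx) ((p : ℝ) * M.dt Nt) - C k p| with hsdef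
  have hs0 : ∀ p, 0 ≤ s p := fun p => mul_nonneg hdx (Finset.sum_nonneg fun k _ => abs_nonneg _)
  set x := (j : ℝ) * M.dx Nx with hxdef
  have hlocal : ∀ p ≤ n, |G (x, (p : ℝ) * M.dt Nt) - M.dqLight n₀ Nx Nl C j p|
      ≤ A₃ * (1 + A₁) * h' + A₃ * A₁ * s p := by
    intro p hp
    have hpt := node_mem_Icc hdt (M.mul_dt hNt) (hp.trans hn')
    have h1 := hspace Nx Nt hNx hNt C j p hj hj' (hp.trans hn')
    have h2 : |M.dqSpace n₀ Nx C j p| ≤ W * (2 * M.L * B) :=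
      abs_gregorySum_le_of_bound hn₀ hj hdx hx.2 hB fun k hk => hCB k p (hk.trans hj') (hp.trans hn')
    have h3 := hlight Nx Nl hNx hNl C j p (V (x, (p : ℝ) * M.dt Nt)) hj'
      ((hBV (x, (p : ℝ) * M.dt Nt) ⟨hx, hpt⟩).trans (le_max_left _ _)) (h2.trans (le_max_right _ _))
    refine h3.trans ?_
    calc A₃ * (M.dlam Nl ^ (n₀ + 1) + |V (x, (p : ℝ) * M.dt Nt) - M.dqSpace n₀ Nx C j p|)
        ≤ A₃ * (h' + A₁ * (h' + s p)) := by
          refine mul_le_mul_of_nonneg_left (add_le_add hHl (h1.trans ?_)) hA₃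
          exact mul_le_mul_of_nonneg_left (add_le_add hHx le_rfl) hA₁
      _ = _ := by ring
  have hsum : M.dt Nt * ∑ p ∈ Finset.range (n + 1),
      |G (x, (p : ℝ) * M.dt Nt) - M.dqLight n₀ Nx Nl C j p|
      ≤ 2 * M.T * (A₃ * (1 + A₁)) * h' + A₃ * A₁ * (M.dt Nt * ∑ p ∈ Finset.range (n + 1), s p) := by
    have h1 : ∑ p ∈ Finset.range (n + 1), |G (x, (p : ℝ) * M.dt Nt) - M.dqLight n₀ Nx Nl C j p|
        ≤ ((n : ℝ) + 1) * (A₃ * (1 + A₁) * h') + A₃ * A₁ * ∑ p ∈ Finset.range (n + 1), s p := by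
      refine (Finset.sum_le_sum fun p hp => hlocal p (by rw [Finset.mem_range] at hp; omega)).trans
        (le_of_eq ?_)
      rw [Finset.sum_add_distrib, ← Finset.mul_sum (Finset.range (n + 1)) s, Finset.sum_const,
        Finset.card_range, nsmul_eq_mul]
      push_cast
      ring
    have h2 : M.dt Nt * ((n : ℝ) + 1) ≤ 2 * M.T := by
      have h3 := (node_mem_Icc hdt (M.mul_dt hNt) (show 1 ≤ Nt from hNt)).2
      rw [Nat.cast_one, one_mul] at h3
      linarith [ht.2]
    calc _ ≤ M.dt Nt * (((n : ℝ) + 1) * (A₃ * (1 + A₁) * h')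
          + A₃ * A₁ * ∑ p ∈ Finset.range (n + 1), s p) := mul_le_mul_of_nonneg_left h1 hdt
      _ = (M.dt Nt * ((n : ℝ) + 1)) * (A₃ * (1 + A₁) * h')
          + A₃ * A₁ * (M.dt Nt * ∑ p ∈ Finset.range (n + 1), s p) := by ring
      _ ≤ 2 * M.T * (A₃ * (1 + A₁) * h')
          + A₃ * A₁ * (M.dt Nt * ∑ p ∈ Finset.range (n + 1), s p) := by
        have := mul_le_mul_of_nonneg_right h2 (show 0 ≤ A₃ * (1 + A₁) * h' by positivity)
        linarith
      _ = _ := by ring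
  set Y := M.dt Nt * ∑ p ∈ Finset.range (n + 1), s p with hYdef
  have hY : 0 ≤ Y := mul_nonneg hdt (Finset.sum_nonneg fun p _ => hs0 p)
  have hdiff : |(∫ τ in (0 : ℝ)..((n : ℝ) * M.dt Nt), G (x, τ))
      - gregorySum n₀ (M.dt Nt) n (fun p => M.dqLight n₀ Nx Nl C j p)|
      ≤ A₂ * h' + W * (2 * M.T * (A₃ * (1 + A₁)) * h' + A₃ * A₁ * Y) := by
    refine (abs_sub_le _ (gregorySum n₀ (M.dt Nt) n (fun p => G (x, (p : ℝ) * M.dt Nt))) _).trans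
      (add_le_add ?_ ?_)
    · exact (htime x hx n hn _ hdt ht.2).trans (mul_le_mul_of_nonneg_left hHt hA₂)
    · rw [gregorySum_sub]
      exact (abs_gregorySum_le hn₀ hn hdt _).trans (mul_le_mul_of_nonneg_left hsum hW)
  have hneg : -M.f x * (∫ τ in (0 : ℝ)..((n : ℝ) * M.dt Nt), G (x, τ)) ≤ D := by
    refine le_trans ?_ hD
    rw [neg_mul, neg_nonpos]
    refine mul_nonneg (hM.f_nonneg x hx) (intervalIntegral.integral_nonneg ht.1 fun τ _ => ?_)
    refine intervalIntegral.integral_nonneg hM.lam_lt.le fun l hl => ?_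
    rw [hψe x hx _ l hl]
    exact hM.rho_nonneg _ (mul_nonneg (hM.I_mem l hl).1 (Real.exp_pos _).le)
  rw [hform x hx _ ht, hC.eq_exp hM hNx hj hj' hn hn', ← mul_sub, abs_mul]
  have hmain := abs_exp_sub_exp_le hneg (hexp Nx Nt Nl hNx hNt hNl C j n hj' hn hn')
  rw [← mul_sub, abs_mul, abs_neg] at hmain
  calc _ ≤ B0 * (Real.exp D * (F * (A₂ * h' + W * (2 * M.T * (A₃ * (1 + A₁)) * h' + A₃ * A₁ * Y)))) := by
        refine mul_le_mul (hB0 x hx) (hmain.trans ?_) (abs_nonneg _) hB00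
        exact mul_le_mul_of_nonneg_left (mul_le_mul (hF x hx) hdiff (abs_nonneg _) hF0)
          (Real.exp_pos _).le
    _ = Q * (A₂ + W * (2 * M.T * (A₃ * (1 + A₁)))) * h' + Q * (W * (A₃ * A₁)) * Y := by
        rw [hQdef]; ring
    _ ≤ _ := by
        have e1 : 0 ≤ Q * (A₂ + W * (2 * M.T * (A₃ * (1 + A₁)))) * Y := by positivity
        have e2 : 0 ≤ Q * (W * (A₃ * A₁)) * h' := by positivity
        linarith

end PhotoModel

theorem mainTheorem2 (M : PhotoModel) (n₀ : ℕ) (hn₀ : 1 ≤ n₀)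
    (hM : M.Admissible) (hsmooth : M.Smooth (n₀ + 1))
    (c : ℝ → ℝ → ℝ) (hc : M.IsSolution c) (K : ℝ) :
    ∃ κ : ℝ, 0 < κ ∧
      ∀ (Nx Nt Nl : ℕ), 0 < Nx → 0 < Nt → n₀ ≤ Nl →
        ∀ C : ℕ → ℕ → ℝ, M.IsDQ n₀ Nx Nt Nl C →
          (∀ j n : ℕ, j ≤ Nx → n ≤ Nt → (j < n₀ ∨ n < n₀) →
            |c ((j : ℝ) * M.dx Nx) ((n : ℝ) * M.dt Nt) - C j n|
              ≤ K * (M.dx Nx + M.dt Nt + M.dlam Nl) ^ (n₀ + 1)) →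
          ∀ j n : ℕ, j ≤ Nx → n ≤ Nt →
            |c ((j : ℝ) * M.dx Nx) ((n : ℝ) * M.dt Nt) - C j n|
              ≤ κ * (M.dx Nx + M.dt Nt + M.dlam Nl) ^ (n₀ + 1) := by
  have hL := hM.L_pos.le
  have hT := hM.T_pos.le
  obtain ⟨B, hB, hCB⟩ := PhotoModel.exists_abs_le_of_isDQ hM hsmooth hn₀ hc K
  obtain ⟨Bc, hBc⟩ := hc.exists_bound
  have hBc0 : 0 ≤ Bc := (abs_nonneg _).trans (hBc 0 ⟨le_rfl, hL⟩ 0 ⟨le_rfl, hT⟩)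
  obtain ⟨A, hA, hrec⟩ := PhotoModel.exists_error_recursion hM hn₀ hsmooth hc hB
  set κ₁ := (1 + A * (2 * M.T * (4 * M.L * Real.exp (4 * M.L * A * M.T)))) * (A + |K|)
  have hκ₁ : 0 ≤ κ₁ := by positivity
  set q := 4 * M.L * A + 1 with hq
  have hq0 : 0 < q := by positivity
  set κ₂ := (Bc + B) * q ^ (n₀ + 1)
  have hκ₂ : 0 ≤ κ₂ := by positivity
  refine ⟨κ₁ + κ₂ + 1, by positivity, fun Nx Nt Nl hNx hNt hNl C hC hstart j n hj hn => ?_⟩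
  have hdx := PhotoModel.dx_pos hM hNx
  have hdt := PhotoModel.dt_pos hM hNt
  have hdl := PhotoModel.dlam_pos hM (show 0 < Nl by omega)
  set H := M.dx Nx + M.dt Nt + M.dlam Nl with hHdef
  have hH : 0 < H := by positivity
  have hHp : 0 < H ^ (n₀ + 1) := pow_pos hH _
  have hCB' := hCB Nx Nt Nl hNx hNt hNl C hC hstart
  by_cases hsmall : q * M.dt Nt ≤ 1
  · have key := discrete_gronwall_grid
      (e := fun j n => |c ((j : ℝ) * M.dx Nx) ((n : ℝ) * M.dt Nt) - C j n|)
      (δ := (A + |K|) * H ^ (n₀ + 1)) (fun _ _ => abs_nonneg _) hNx hNt hdx.le hdt.le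
      (M.mul_dx hNx) (M.mul_dt hNt) hA (by positivity) (by rw [hq] at hsmall; nlinarith)
      (fun j hj n hn => ?_) j hj n hn
    · refine key.trans ?_
      rw [← mul_assoc]
      exact mul_le_mul_of_nonneg_right (by linarith) hHp.le
    · set Y := M.dt Nt * ∑ p ∈ Finset.range (n + 1), M.dx Nx * ∑ k ∈ Finset.range (Nx + 1),
        |c ((k : ℝ) * M.dx Nx) ((p : ℝ) * M.dt Nt) - C k p|
      have hY : 0 ≤ Y := by positivity
      by_cases hst : j < n₀ ∨ n < n₀
      · refine (hstart j n hj hn hst).trans ?_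
        have h1 := mul_le_mul_of_nonneg_right (le_abs_self K) hHp.le
        have h2 : 0 ≤ A * H ^ (n₀ + 1) := by positivity
        have h3 : 0 ≤ A * Y := by positivity
        linarith
      · push Not at hst
        refine (hrec Nx Nt Nl hNx hNt hNl C hC hCB' j n hst.1 hj hst.2 hn).trans ?_
        have h1 : 0 ≤ |K| * H ^ (n₀ + 1) := by positivity
        linarith
  · push Not at hsmall
    have h1 : (1 : ℝ) ≤ q ^ (n₀ + 1) * H ^ (n₀ + 1) := by
      rw [← mul_pow]
      refine one_le_pow₀ (hsmall.le.trans (mul_le_mul_of_nonneg_left ?_ hq0.le))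
      rw [hHdef]; linarith
    have hx := PhotoModel.node_mem_Icc hdx.le (M.mul_dx hNx) hj
    have ht := PhotoModel.node_mem_Icc hdt.le (M.mul_dt hNt) hn
    calc _ ≤ Bc + B := (abs_sub _ _).trans (add_le_add (hBc _ hx _ ht) (hCB' j n hj hn))
      _ ≤ (Bc + B) * (q ^ (n₀ + 1) * H ^ (n₀ + 1)) := le_mul_of_one_le_right (by positivity) h1
      _ = κ₂ * H ^ (n₀ + 1) := by ring
      _ ≤ _ := mul_le_mul_of_nonneg_right (by linarith) hHp.le

end
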